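/- Let $q$ be a complex-valued summable function on $[0,1]$ with $\int_0^1 q(t)\,dt=0$, and let $L$ be the operator generated in $L_2[0,1]$ by the expression $-y''+q\,y$ and the periodic boundary conditions $y(1)=y(0)$, $y'(1)=y'(0)$. For $m\in\mathbb{N}$ put $$\rho(m)=\max\left\{\sup_{0\le x\le 1}\left|\int_0^x q(t)\,e^{-i2(2m)\pi t}\,dt\right|,\ \sup_{0\le x\le 1}\left|\int_0^x q(t)\,e^{i2(2m)\pi t}\,dt\right|\right\}.$$ Then the following hold. (a) All eigenvalues of $L$ of sufficiently large modulus, repeated according to their algebraic multiplicity (the dimension of the root subspace), can be listed in pairs $\lambda_{m,1},\lambda_{m,2}$, $m\ge N$, for some positive integer $N$ depending on $q$, in such a way that for $j=1,2$ $$\lambda_{m,j}=(2m\pi)^2+O(\rho(m)),$$ that is, there is a constant $C$, depending only on $q$, with $|\lambda_{m,j}-(2m\pi)^2|\le C\rho(m)$ for all $m\ge N$ and $j=1,2$. (b) If $q$ is not zero almost everywhere, then there are a constant $c>0$ and a positive integer $N'$, depending only on $q$, such that $\rho(m)>c\,m^{-1}$ for all $m\ge N'$. -/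

import Mathlib

open MeasureTheory Set
open scoped Real

/-- Lebesgue measure on `[0,1]`. -/
noncomputable def vol01 : Measure ℝ := volume.restrict (Icc (0 : ℝ) 1)

/-- The complex Hilbert space `L₂[0,1]`. -/
abbrev L2 : Type := Lp ℂ 2 vol01

/-- `PeriodicSL q u v` : `u` lies in the domain of the operator `L` generated in `L₂[0,1]` by
`-y'' + q y` with the boundary conditions `y(1) = y(0)`, `y'(1) = y'(0)`, and `L u = v`.
That is, `u` has a representative `y` which is differentiable on `[0,1]` (one-sided at the end
points) with absolutely continuous derivative `dy`, such that `-y'' + q y = v` a.e. in `[0,1]`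
(in particular `-y'' + q y ∈ L₂[0,1]`), and `y` satisfies the boundary conditions. -/
def PeriodicSL (q : ℝ → ℂ) (u v : L2) : Prop :=
  ∃ y dy : ℝ → ℂ,
    u =ᵐ[vol01] y ∧
    (∀ x ∈ Icc (0 : ℝ) 1, HasDerivWithinAt y (dy x) (Icc 0 1) x) ∧
    AbsolutelyContinuousOnInterval dy 0 1 ∧
    (∀ᵐ x ∂vol01, HasDerivAt dy (q x * y x - v x) x) ∧
    y 1 = y 0 ∧ dy 1 = dy 0

theorem PeriodicSL.zero (q : ℝ → ℂ) : PeriodicSL q 0 0 := by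
  refine ⟨0, 0, Lp.coeFn_zero ℂ 2 vol01, fun x _ => hasDerivWithinAt_const x _ (0 : ℂ), ?_, ?_,
    rfl, rfl⟩
  · have h := (LipschitzWith.const (0 : ℂ)).lipschitzOnWith
      (s := uIcc (0 : ℝ) 1) |>.absolutelyContinuousOnInterval
    exact h
  · filter_upwards [Lp.coeFn_zero ℂ 2 vol01] with x hx
    rw [hx]
    simp [hasDerivAt_zero]

theorem PeriodicSL.add {q : ℝ → ℂ} {u v u' v' : L2}
    (h : PeriodicSL q u v) (h' : PeriodicSL q u' v') : PeriodicSL q (u + u') (v + v') := by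
  obtain ⟨y, dy, h1, h2, h3, h4, h5, h6⟩ := h
  obtain ⟨z, dz, k1, k2, k3, k4, k5, k6⟩ := h'
  refine ⟨y + z, dy + dz, (Lp.coeFn_add u u').trans (h1.add k1),
    fun x hx => (h2 x hx).add (k2 x hx), h3.add k3, ?_, ?_, ?_⟩
  · filter_upwards [h4, k4, Lp.coeFn_add v v'] with x a b c
    rw [c]
    refine (a.add b).congr_deriv ?_
    simp only [Pi.add_apply]
    ring
  · simp [h5, k5]
  · simp [h6, k6]

theorem PeriodicSL.smul {q : ℝ → ℂ} {u v : L2} (c : ℂ)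
    (h : PeriodicSL q u v) : PeriodicSL q (c • u) (c • v) := by
  obtain ⟨y, dy, h1, h2, h3, h4, h5, h6⟩ := h
  refine ⟨c • y, c • dy, (Lp.coeFn_smul c u).trans (h1.const_smul c),
    fun x hx => (h2 x hx).const_smul c, h3.const_smul c, ?_, ?_, ?_⟩
  · filter_upwards [h4, Lp.coeFn_smul c v] with x a b
    rw [b]
    refine (a.const_smul c).congr_deriv ?_
    simp only [Pi.smul_apply, smul_eq_mul]
    ring
  · simp [h5]
  · simp [h6]

/-- `z` is an eigenvalue of `L` : `L u = z u` for some nonzero `u` in the domain of `L`. -/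
def IsPeriodicEigenvalue (q : ℝ → ℂ) (z : ℂ) : Prop :=
  ∃ u : L2, u ≠ 0 ∧ PeriodicSL q u (z • u)

/-- The kernel of `(L - z)^n`. -/
noncomputable def periodicKer (q : ℝ → ℂ) (z : ℂ) : ℕ → Submodule ℂ L2
  | 0 => ⊥
  | n + 1 =>
    { carrier := {u | ∃ v, PeriodicSL q u v ∧ v - z • u ∈ periodicKer q z n}
      zero_mem' := ⟨0, PeriodicSL.zero q, by simp⟩
      add_mem' := by
        rintro u u' ⟨v, h, hv⟩ ⟨v', h', hv'⟩
        refine ⟨v + v', h.add h', ?_⟩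
        have e : v + v' - z • (u + u') = (v - z • u) + (v' - z • u') := by
          rw [smul_add]; abel
        rw [e]
        exact Submodule.add_mem _ hv hv'
      smul_mem' := by
        rintro c u ⟨v, h, hv⟩
        refine ⟨c • v, h.smul c, ?_⟩
        have e : c • v - z • c • u = c • (v - z • u) := by
          rw [smul_sub, smul_comm]
        rw [e]
        exact Submodule.smul_mem _ c hv }

/-- The algebraic multiplicity of `z` as an eigenvalue of `L`: the dimension of its root subspace
`⋃ n, ker (L - z)^n` (zero if `z` is not an eigenvalue). -/
noncomputable def periodicMult (q : ℝ → ℂ) (z : ℂ) : ℕ∞ :=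
  Cardinal.toENat (Module.rank ℂ ↥(⨆ n, periodicKer q z n))

/-- `ρ(m) = max (sup_{0≤x≤1} |∫₀ˣ q(t) e^{-i2(2m)πt} dt|) (sup_{0≤x≤1} |∫₀ˣ q(t) e^{i2(2m)πt} dt|)`. -/
noncomputable def rho (q : ℝ → ℂ) (m : ℕ) : ℝ :=
  max
    (⨆ x : Icc (0 : ℝ) 1,
      ‖∫ t in (0 : ℝ)..x, q t * Complex.exp (-(Complex.I * 2 * (2 * m) * π * t))‖)
    (⨆ x : Icc (0 : ℝ) 1,
      ‖∫ t in (0 : ℝ)..x, q t * Complex.exp (Complex.I * 2 * (2 * m) * π * t)‖)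

/-! Write Q = ∫|q| and κ = 2πim, so that e^{±κx} span the eigenspace of the unperturbed operator at
-κ² = (2πm)². For large m this plane deforms to an L-invariant plane spanned by φ_j = e^{±κx} + X_j,
with X_j orthogonal to both exponentials and Lφ_j = -κ²φ_j + ∑ B_kj φ_k. Projecting this equation
onto the exponentials forces B_kj to be the k-th coefficient of qφ_j. The complementary part is a
quadratic (Riccati) fixed-point equation for X. The Green operator maps L¹ to sup norm with size
O(1/|κ|), so the fixed-point map is a contraction and X = O(1/m) (`exists_riccati_solution`,
`exists_invariant_pair`).

Hence B is the matrix of q on the exponentials up to O(Q²/m). Its leading diagonal entries are ∫q =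
0, and the others are Fourier coefficients of q at ±4πm, bounded by ρ(m). The eigenvalues of L on
the plane are thus (2πm)² + O(ρ(m) + Q²/m).

For completeness, every eigenvalue of large modulus lies within 4Q + 1 of some (2πm)²
(`exists_nat_norm_sub_le_of_periodicSL`). For z in such a disc with m large, every root vector lies
in the plane (`exists_invariant_subspace`), so the algebraic multiplicity is a root multiplicity of
a 2×2 characteristic polynomial (`periodicMult_eq_rootMultiplicity`). The discs are disjoint for
large m.

Part (b) is integration by parts: recovering ∫₀ˣ q from ∫₀ˣ q e^{ct}, with |c| = 4πm, costs a factor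
1 + 4πm (`norm_integral_le_mul_rho`), and some ∫₀ˣ q is nonzero unless q = 0 a.e. Part (b) also
absorbs the error Q²/m of part (a) into ρ(m); when q = 0 a.e. that error is zero. -/

/-! ### Integrals and absolutely continuous functions on [0,1]. -/

theorem ae_vol01_iff {p : ℝ → Prop} :
    (∀ᵐ x ∂vol01, p x) ↔ ∀ᵐ x, x ∈ Icc (0 : ℝ) 1 → p x :=
  ae_restrict_iff' measurableSet_Icc

theorem ae_vol01_mem_Ioo : ∀ᵐ x ∂vol01, x ∈ Ioo (0 : ℝ) 1 := by
  rw [ae_vol01_iff]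
  have h0 : ∀ᵐ x : ℝ, x ≠ 0 := by simp [ae_iff]
  have h1 : ∀ᵐ x : ℝ, x ≠ 1 := by simp [ae_iff]
  filter_upwards [h0, h1] with x a b c
  exact ⟨lt_of_le_of_ne c.1 (Ne.symm a), lt_of_le_of_ne c.2 b⟩

theorem intervalIntegrable_of_mem {E : Type*} [NormedAddCommGroup E] {f : ℝ → E}
    (hf : IntervalIntegrable f volume 0 1) {x y : ℝ} (hx : x ∈ Icc (0 : ℝ) 1)
    (hy : y ∈ Icc (0 : ℝ) 1) : IntervalIntegrable f volume x y :=
  hf.mono_set (by rw [uIcc_of_le zero_le_one]; exact uIcc_subset_Icc hx hy)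

theorem integral_norm_le_of_mem {E : Type*} [NormedAddCommGroup E] {f : ℝ → E}
    (hf : IntervalIntegrable f volume 0 1) {x y : ℝ} (hx : x ∈ Icc (0 : ℝ) 1)
    (hy : y ∈ Icc (0 : ℝ) 1) (hxy : x ≤ y) : ∫ t in x..y, ‖f t‖ ≤ ∫ t in (0 : ℝ)..1, ‖f t‖ := by
  apply intervalIntegral.integral_mono_interval hx.1 hxy hy.2
  · exact Filter.Eventually.of_forall fun t => norm_nonneg _
  · exact hf.norm

theorem integral_congr_vol01 {E : Type*} [NormedAddCommGroup E] [NormedSpace ℝ E] {f g : ℝ → E}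
    (h : f =ᵐ[vol01] g) : ∫ t in (0 : ℝ)..1, f t = ∫ t in (0 : ℝ)..1, g t := by
  apply intervalIntegral.integral_congr_ae
  filter_upwards [ae_vol01_iff.1 h] with x hx hx'
  rw [uIoc_of_le zero_le_one] at hx'
  exact hx ⟨hx'.1.le, hx'.2⟩

theorem absolutelyContinuousOnInterval_of_norm_sub_le {E F : Type*} [NormedAddCommGroup E]
    [NormedAddCommGroup F]
    {f : ℝ → E} {g : ℝ → F} {a b : ℝ}
    (hg : AbsolutelyContinuousOnInterval g a b)
    (h : ∀ x ∈ uIcc a b, ∀ y ∈ uIcc a b, ‖f x - f y‖ ≤ ‖g x - g y‖) :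
    AbsolutelyContinuousOnInterval f a b := by
  rw [absolutelyContinuousOnInterval_iff] at hg ⊢
  intro ε hε
  obtain ⟨δ, hδ, H⟩ := hg ε hε
  refine ⟨δ, hδ, fun I hI hs => lt_of_le_of_lt (Finset.sum_le_sum fun i hi => ?_) (H I hI hs)⟩
  rw [dist_eq_norm, dist_eq_norm]
  exact h _ (hI.1 i hi).1 _ (hI.1 i hi).2

theorem absolutelyContinuousOnInterval_integral {E : Type*} [NormedAddCommGroup E]
    [NormedSpace ℝ E] {f : ℝ → E}
    (hf : IntervalIntegrable f volume 0 1) :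
    AbsolutelyContinuousOnInterval (fun x => ∫ t in (0 : ℝ)..x, f t) 0 1 := by
  apply absolutelyContinuousOnInterval_of_norm_sub_le
    (hf.norm.absolutelyContinuousOnInterval_intervalIntegral (c := 0) (by simp))
  intro x hx y hy
  rw [uIcc_of_le zero_le_one] at hx hy
  have h0 : (0 : ℝ) ∈ Icc (0 : ℝ) 1 := by simp
  rw [intervalIntegral.integral_interval_sub_left (intervalIntegrable_of_mem hf h0 hx)
    (intervalIntegrable_of_mem hf h0 hy), intervalIntegral.integral_interval_sub_left
    (intervalIntegrable_of_mem hf h0 hx).norm (intervalIntegrable_of_mem hf h0 hy).norm]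
  exact intervalIntegral.norm_integral_le_abs_integral_norm

/-- Subtracting the primitive of f leaves an absolutely continuous function with zero derivative
a.e., which is constant. -/
theorem AbsolutelyContinuousOnInterval.eq_add_integral {E : Type*} [NormedAddCommGroup E] [NormedSpace ℝ E]
    [CompleteSpace E] {a f : ℝ → E}
    (ha : AbsolutelyContinuousOnInterval a 0 1) (hf : IntervalIntegrable f volume 0 1)
    (h : ∀ᵐ x ∂vol01, HasDerivAt a (f x) x) {x : ℝ} (hx : x ∈ Icc (0 : ℝ) 1) :
    a x = a 0 + ∫ t in (0 : ℝ)..x, f t := by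
  obtain ⟨C, hC⟩ := (ha.sub (absolutelyContinuousOnInterval_integral hf)).const_of_ae_hasDerivAt_zero
    (by
      filter_upwards [ae_vol01_iff.1 h, hf.ae_hasDerivAt_integral] with t h1 h2 ht
      have h3 := h2 ht 0 (by simp)
      rw [uIcc_of_le zero_le_one] at ht
      simpa using (h1 ht).sub h3)
  have h1 := hC x (by rwa [uIcc_of_le zero_le_one])
  have h0 := hC 0 (by simp)
  simp only [Pi.sub_apply, intervalIntegral.integral_same, sub_zero] at h0 h1
  rw [h0, ← h1]; abel

theorem AbsolutelyContinuousOnInterval.of_hasDerivWithinAt {E : Type*} [NormedAddCommGroup E] [NormedSpace ℝ E]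
    {y dy : ℝ → E}
    (h : ∀ x ∈ Icc (0 : ℝ) 1, HasDerivWithinAt y (dy x) (Icc 0 1) x)
    (hc : ContinuousOn dy (Icc 0 1)) : AbsolutelyContinuousOnInterval y 0 1 := by
  obtain ⟨C, hC⟩ := isCompact_Icc.exists_bound_of_continuousOn hc
  have hC' : ∀ x ∈ Icc (0 : ℝ) 1, ‖dy x‖₊ ≤ C.toNNReal := fun x hx => by
    rw [← NNReal.coe_le_coe, coe_nnnorm]
    exact (hC x hx).trans (Real.le_coe_toNNReal C)
  have := (convex_Icc (0 : ℝ) 1).lipschitzOnWith_of_nnnorm_hasDerivWithin_le h hC'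
  rw [← uIcc_of_le zero_le_one] at this
  exact this.absolutelyContinuousOnInterval

theorem hasDerivAt_of_within_Icc {E : Type*} [NormedAddCommGroup E] [NormedSpace ℝ E] {y : ℝ → E} {d : E} {x : ℝ}
    (h : HasDerivWithinAt y d (Icc 0 1) x) (hx : x ∈ Ioo (0 : ℝ) 1) : HasDerivAt y d x :=
  h.hasDerivAt (Icc_mem_nhds hx.1 hx.2)

theorem hasDerivWithinAt_of_eq_add_integral {E : Type*} [NormedAddCommGroup E] [NormedSpace ℝ E]
    [CompleteSpace E] {y dy : ℝ → E} (hc : ContinuousOn dy (Icc 0 1))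
    (h : ∀ x ∈ Icc (0 : ℝ) 1, y x = y 0 + ∫ t in (0 : ℝ)..x, dy t) {x : ℝ}
    (hx : x ∈ Icc (0 : ℝ) 1) : HasDerivWithinAt y (dy x) (Icc 0 1) x := by
  -- Extending `dy` by constants makes it continuous on ℝ, so the two-sided fundamental theorem also
  -- covers the end points.
  have hc' : Continuous (IccExtend zero_le_one (domRestrict (Icc (0 : ℝ) 1) dy)) :=
    hc.domRestrict.Icc_extend'
  have hd := (intervalIntegral.integral_hasDerivAt_right (hc'.intervalIntegrable 0 x)
    (hc'.stronglyMeasurableAtFilter _ _) hc'.continuousAt).const_add (y 0)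
  rw [IccExtend_of_mem _ _ hx] at hd
  refine hd.hasDerivWithinAt.congr (fun t ht => ?_) ?_
  · rw [h t ht]
    congr 1
    apply intervalIntegral.integral_congr
    intro r hr
    rw [uIcc_of_le ht.1] at hr
    simp [IccExtend_of_mem _ _ (⟨hr.1, hr.2.trans ht.2⟩ : r ∈ Icc (0 : ℝ) 1), domRestrict]
  · rw [h x hx]
    congr 1
    apply intervalIntegral.integral_congr
    intro r hr
    rw [uIcc_of_le hx.1] at hr
    simp [IccExtend_of_mem _ _ (⟨hr.1, hr.2.trans hx.2⟩ : r ∈ Icc (0 : ℝ) 1), domRestrict]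

/-! ### The first-order equation a' = κa + f. -/

theorem hasDerivAt_cexp_mul (κ : ℂ) (x : ℝ) :
    HasDerivAt (fun t : ℝ => Complex.exp (κ * t)) (κ * Complex.exp (κ * x)) x := by
  have := ((Complex.ofRealCLM.hasDerivAt (x := x)).const_mul κ).cexp
  simpa [mul_comm] using this

theorem continuous_cexp_mul (κ : ℂ) : Continuous fun t : ℝ => Complex.exp (κ * t) := by fun_prop

theorem absolutelyContinuousOnInterval_cexp_mul (κ : ℂ) :
    AbsolutelyContinuousOnInterval (fun t : ℝ => Complex.exp (κ * t)) 0 1 :=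
  AbsolutelyContinuousOnInterval.of_hasDerivWithinAt
    (fun x _ => (hasDerivAt_cexp_mul κ x).hasDerivWithinAt) (by fun_prop)

theorem intervalIntegrable_cexp_mul {f : ℝ → ℂ} (hf : IntervalIntegrable f volume 0 1) (κ : ℂ) :
    IntervalIntegrable (fun t => Complex.exp (κ * t) * f t) volume 0 1 :=
  hf.continuousOn_mul (continuous_cexp_mul κ).continuousOn

/-- `∫₀ˣ e^{-κt} f(t) dt`. -/
noncomputable def expPrimitive (κ : ℂ) (f : ℝ → ℂ) (x : ℝ) : ℂ :=
  ∫ t in (0 : ℝ)..x, Complex.exp (-κ * t) * f t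

/-- Variation of constants for `a' = κ a + f`. -/
theorem variation_of_constants {κ : ℂ} {a f : ℝ → ℂ} (ha : AbsolutelyContinuousOnInterval a 0 1)
    (hf : IntervalIntegrable f volume 0 1)
    (h : ∀ᵐ x ∂vol01, HasDerivAt a (κ * a x + f x) x) {x : ℝ} (hx : x ∈ Icc (0 : ℝ) 1) :
    Complex.exp (-κ * x) * a x = a 0 + expPrimitive κ f x := by
  have h1 := ((absolutelyContinuousOnInterval_cexp_mul (-κ)).smul ha).eq_add_integral
    (intervalIntegrable_cexp_mul hf (-κ)) (by
      filter_upwards [h] with t ht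
      refine ((hasDerivAt_cexp_mul (-κ) t).mul ht).congr_deriv ?_
      ring) hx
  simpa [expPrimitive] using h1

/-- The sign condition says that the kernel e^{κ(s-t)} has modulus at most 1 on the range of
integration. -/
theorem norm_exp_mul_integral_le {κ : ℂ} {f : ℝ → ℂ} (hf : IntervalIntegrable f volume 0 1)
    {s x y : ℝ} (hx : x ∈ Icc (0 : ℝ) 1) (hy : y ∈ Icc (0 : ℝ) 1) (hxy : x ≤ y)
    (h : ∀ t ∈ Icc x y, κ.re * (s - t) ≤ 0) :
    ‖Complex.exp (κ * s) * ∫ t in x..y, Complex.exp (-κ * t) * f t‖ ≤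
      ∫ t in (0 : ℝ)..1, ‖f t‖ := by
  rw [← intervalIntegral.integral_const_mul]
  refine le_trans ?_ (integral_norm_le_of_mem hf hx hy hxy)
  refine intervalIntegral.norm_integral_le_of_norm_le hxy ?_ (intervalIntegrable_of_mem hf hx hy).norm
  refine Filter.Eventually.of_forall fun t ht => ?_
  rw [← mul_assoc, ← Complex.exp_add, norm_mul, Complex.norm_exp]
  refine mul_le_of_le_one_left (norm_nonneg _) (Real.exp_le_one_iff.2 ?_)
  refine le_trans (le_of_eq ?_) (h t ⟨ht.1.le, ht.2⟩)
  simp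
  ring

theorem zero_mem_Icc01 : (0 : ℝ) ∈ Icc (0 : ℝ) 1 := by simp

theorem one_mem_Icc01 : (1 : ℝ) ∈ Icc (0 : ℝ) 1 := by simp

theorem exp_mul_exp_neg (κ : ℂ) (x : ℝ) : Complex.exp (κ * x) * Complex.exp (-κ * x) = 1 := by
  rw [← Complex.exp_add]; simp

theorem norm_exp_mul_of_re_eq_zero {κ : ℂ} (h : κ.re = 0) (x : ℝ) :
    ‖Complex.exp (κ * x)‖ = 1 := by
  simp [Complex.norm_exp, h]

/-- Periodicity gives a(0)(1 - e^κ) = ∫ e^{κ(1-t)} f(t) dt. For Re κ ≤ 0 this kernel and that of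
forward propagation are bounded by 1, so the estimate is uniform in κ. -/
theorem norm_periodic_le_of_re_nonpos {κ : ℂ} {a f : ℝ → ℂ}
    (hf : IntervalIntegrable f volume 0 1) (hκ : κ.re ≤ 0) (hp : a 1 = a 0)
    (h : ∀ x ∈ Icc (0 : ℝ) 1, Complex.exp (-κ * x) * a x = a 0 + expPrimitive κ f x)
    {x : ℝ} (hx : x ∈ Icc (0 : ℝ) 1) :
    ‖a x‖ * ‖1 - Complex.exp κ‖ ≤ (∫ t in (0 : ℝ)..1, ‖f t‖) * (1 + ‖1 - Complex.exp κ‖) := by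
  have hb : ∀ x ∈ Icc (0 : ℝ) 1, ‖Complex.exp (κ * x) * expPrimitive κ f x‖ ≤
      ∫ t in (0 : ℝ)..1, ‖f t‖ := fun x hx =>
    norm_exp_mul_integral_le hf zero_mem_Icc01 hx hx.1 fun t ht =>
      mul_nonpos_of_nonpos_of_nonneg hκ (sub_nonneg.2 ht.2)
  have hs : ∀ x ∈ Icc (0 : ℝ) 1,
      a x = Complex.exp (κ * x) * a 0 + Complex.exp (κ * x) * expPrimitive κ f x := fun x hx => by
    rw [← mul_add, ← h x hx, ← mul_assoc, exp_mul_exp_neg, one_mul]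
  have h1 : a 0 * (1 - Complex.exp κ) = Complex.exp (κ * (1 : ℝ)) * expPrimitive κ f 1 := by
    have := hs 1 one_mem_Icc01
    rw [hp] at this
    rw [eq_sub_of_add_eq' this.symm]
    push_cast
    ring_nf
  have h2 : ‖a 0‖ * ‖1 - Complex.exp κ‖ ≤ ∫ t in (0 : ℝ)..1, ‖f t‖ := by
    rw [← norm_mul, h1]; exact hb 1 one_mem_Icc01
  have h3 : ‖Complex.exp (κ * x)‖ ≤ 1 := by
    rw [Complex.norm_exp, Real.exp_le_one_iff]
    simpa using mul_nonpos_of_nonpos_of_nonneg hκ hx.1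
  have h4 : ‖a x‖ ≤ ‖a 0‖ + ∫ t in (0 : ℝ)..1, ‖f t‖ := by
    rw [hs x hx]
    refine (norm_add_le _ _).trans (add_le_add ?_ (hb x hx))
    rw [norm_mul]
    exact mul_le_of_le_one_left (norm_nonneg _) h3
  nlinarith [norm_nonneg (1 - Complex.exp κ)]

theorem norm_periodic_le_of_re_nonneg {κ : ℂ} {a f : ℝ → ℂ}
    (hf : IntervalIntegrable f volume 0 1) (hκ : 0 ≤ κ.re) (hp : a 1 = a 0)
    (h : ∀ x ∈ Icc (0 : ℝ) 1, Complex.exp (-κ * x) * a x = a 0 + expPrimitive κ f x)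
    {x : ℝ} (hx : x ∈ Icc (0 : ℝ) 1) :
    ‖a x‖ * ‖1 - Complex.exp (-κ)‖ ≤
      (∫ t in (0 : ℝ)..1, ‖f t‖) * (1 + ‖1 - Complex.exp (-κ)‖) := by
  have hi := intervalIntegrable_cexp_mul hf (-κ)
  have h0 : a 0 * (1 - Complex.exp (-κ)) = -expPrimitive κ f 1 := by
    have := h 1 one_mem_Icc01
    rw [hp] at this
    push_cast at this
    rw [mul_one] at this
    linear_combination -this
  have hb : ‖expPrimitive κ f 1‖ ≤ ∫ t in (0 : ℝ)..1, ‖f t‖ := by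
    have := norm_exp_mul_integral_le (κ := κ) (s := 0) hf zero_mem_Icc01 one_mem_Icc01 zero_le_one
      fun t ht => mul_nonpos_of_nonneg_of_nonpos hκ (by linarith [ht.1])
    simpa [expPrimitive] using this
  have h2 : ‖a 0‖ * ‖1 - Complex.exp (-κ)‖ ≤ ∫ t in (0 : ℝ)..1, ‖f t‖ := by
    rw [← norm_mul, h0, norm_neg]; exact hb
  -- For Re κ ≥ 0 the solution is propagated backwards from x = 1, which keeps all kernels bounded
  -- by 1.
  have hs : a x = Complex.exp (κ * (x - 1 : ℝ)) * a 0 -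
      Complex.exp (κ * x) * ∫ t in x..1, Complex.exp (-κ * t) * f t := by
    have e1 := h 1 one_mem_Icc01
    have ex := h x hx
    have e2 : expPrimitive κ f 1 = expPrimitive κ f x + ∫ t in x..1, Complex.exp (-κ * t) * f t :=
      (intervalIntegral.integral_add_adjacent_intervals
        (intervalIntegrable_of_mem hi zero_mem_Icc01 hx)
        (intervalIntegrable_of_mem hi hx one_mem_Icc01)).symm
    have e3 : Complex.exp (κ * (x - 1 : ℝ)) = Complex.exp (κ * x) * Complex.exp (-κ * (1 : ℝ)) := by
      rw [← Complex.exp_add]; push_cast; ring_nf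
    rw [hp] at e1
    rw [e3]
    have e4 := exp_mul_exp_neg κ x
    linear_combination Complex.exp (κ * x) * (ex - e1 - e2) - a x * e4
  have h3 : ‖Complex.exp (κ * (x - 1 : ℝ))‖ ≤ 1 := by
    rw [Complex.norm_exp, Real.exp_le_one_iff, Complex.re_mul_ofReal]
    exact mul_nonpos_of_nonneg_of_nonpos hκ (by linarith [hx.2])
  have h4 : ‖a x‖ ≤ ‖a 0‖ + ∫ t in (0 : ℝ)..1, ‖f t‖ := by
    rw [hs]
    refine (norm_sub_le _ _).trans (add_le_add ?_ ?_)
    · rw [norm_mul]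
      exact mul_le_of_le_one_left (norm_nonneg _) h3
    · exact norm_exp_mul_integral_le hf hx one_mem_Icc01 hx.2 fun t ht =>
        mul_nonpos_of_nonneg_of_nonpos hκ (by linarith [ht.1])
  nlinarith [norm_nonneg (1 - Complex.exp (-κ))]

/-! ### Periodic solutions of y'' = f + κ²y. -/

/-- `y` solves `y'' = f` on `[0,1]` (with `y' = dy` absolutely continuous) and is periodic. -/
structure IsPeriodicSolution (f y dy : ℝ → ℂ) : Prop where
  hasDeriv : ∀ x ∈ Icc (0 : ℝ) 1, HasDerivWithinAt y (dy x) (Icc 0 1) x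
  ac : AbsolutelyContinuousOnInterval dy 0 1
  ae_hasDeriv : ∀ᵐ x ∂vol01, HasDerivAt dy (f x) x
  periodic : y 1 = y 0
  periodic_deriv : dy 1 = dy 0

namespace IsPeriodicSolution
variable {f g y dy : ℝ → ℂ} {κ c : ℂ}

theorem congr (h : IsPeriodicSolution f y dy) (hfg : f =ᵐ[vol01] g) :
    IsPeriodicSolution g y dy :=
  ⟨h.1, h.2, by filter_upwards [h.3, hfg] with x h1 h2; rwa [← h2], h.4, h.5⟩

theorem continuousOn_deriv (h : IsPeriodicSolution f y dy) : ContinuousOn dy (Icc 0 1) := by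
  simpa using h.ac.continuousOn

theorem continuousOn (h : IsPeriodicSolution f y dy) : ContinuousOn y (Icc 0 1) :=
  fun x hx => (h.hasDeriv x hx).continuousWithinAt

theorem ac_self (h : IsPeriodicSolution f y dy) : AbsolutelyContinuousOnInterval y 0 1 :=
  .of_hasDerivWithinAt h.hasDeriv h.continuousOn_deriv

theorem ae_hasDeriv_self (h : IsPeriodicSolution f y dy) : ∀ᵐ x ∂vol01, HasDerivAt y (dy x) x := by
  filter_upwards [ae_vol01_mem_Ioo] with x hx
  exact hasDerivAt_of_within_Icc (h.hasDeriv x (Ioo_subset_Icc_self hx)) hx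

/-- Factoring y'' - κ²y = (d/dx - κ)(d/dx + κ)y makes a = y' + κy a solution of the first-order
equation a' = κa + f. -/
theorem variation_of_constants (h : IsPeriodicSolution (fun x => f x + c * y x) y dy)
    (hc : κ ^ 2 = c) (hf : IntervalIntegrable f volume 0 1) {x : ℝ} (hx : x ∈ Icc (0 : ℝ) 1) :
    Complex.exp (-κ * x) * (dy x + κ * y x) = (dy 0 + κ * y 0) + expPrimitive κ f x := by
  refine _root_.variation_of_constants (a := fun x => dy x + κ * y x)
    (h.ac.add (h.ac_self.const_smul κ)) hf ?_ hx
  filter_upwards [h.ae_hasDeriv, h.ae_hasDeriv_self] with t h1 h2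
  refine (h1.add (h2.const_mul κ)).congr_deriv ?_
  rw [← hc]; ring

/-- Integration by parts; the boundary terms cancel because both y and e^{-κx} are periodic. -/
theorem integral_exp_mul (h : IsPeriodicSolution f y dy) (hκ : Complex.exp κ = 1) :
    ∫ x in (0 : ℝ)..1, Complex.exp (-κ * x) * (dy x + κ * y x) =
      2 * κ * ∫ x in (0 : ℝ)..1, Complex.exp (-κ * x) * y x := by
  have hy : IntervalIntegrable y volume 0 1 := h.ac_self.continuousOn.intervalIntegrable
  have hdy : IntervalIntegrable dy volume 0 1 := h.ac.continuousOn.intervalIntegrable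
  have iy := intervalIntegrable_cexp_mul hy (-κ)
  have idy := intervalIntegrable_cexp_mul hdy (-κ)
  have h1 := ((absolutelyContinuousOnInterval_cexp_mul (-κ)).smul h.ac_self).eq_add_integral
    (idy.sub (iy.const_mul κ)) (by
      filter_upwards [h.ae_hasDeriv_self] with t ht
      refine ((hasDerivAt_cexp_mul (-κ) t).mul ht).congr_deriv ?_
      ring) one_mem_Icc01
  rw [intervalIntegral.integral_sub idy (iy.const_mul κ),
    intervalIntegral.integral_const_mul] at h1
  have hκ' : Complex.exp (-κ) = 1 := by rw [Complex.exp_neg, hκ, inv_one]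
  simp only [Pi.smul_apply', smul_eq_mul, Complex.ofReal_one, mul_one, hκ', Complex.ofReal_zero,
    mul_zero, Complex.exp_zero, h.periodic] at h1
  have h2 : ∀ x : ℝ, Complex.exp (-κ * x) * (dy x + κ * y x) =
      Complex.exp (-κ * x) * dy x + κ * (Complex.exp (-κ * x) * y x) := fun x => by ring
  simp_rw [h2]
  rw [intervalIntegral.integral_add idy (iy.const_mul κ), intervalIntegral.integral_const_mul]
  linear_combination -h1

/-- Both y' + κy and y' - κy obey first-order bounds, and their difference is 2κy. -/
theorem norm_mul_le (h : IsPeriodicSolution (fun x => f x + κ ^ 2 * y x) y dy) (hκ : κ.re ≤ 0)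
    (hf : IntervalIntegrable f volume 0 1) {x : ℝ} (hx : x ∈ Icc (0 : ℝ) 1) :
    ‖κ‖ * ‖y x‖ * ‖1 - Complex.exp κ‖ ≤
      (∫ t in (0 : ℝ)..1, ‖f t‖) * (1 + ‖1 - Complex.exp κ‖) := by
  have h1 := norm_periodic_le_of_re_nonpos (a := fun x => dy x + κ * y x) hf hκ
    (by simp [h.periodic, h.periodic_deriv]) (fun x hx => h.variation_of_constants rfl hf hx) hx
  have h2 := norm_periodic_le_of_re_nonneg (κ := -κ) (a := fun x => dy x + -κ * y x) hf (by simpa)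
    (by simp [h.periodic, h.periodic_deriv])
    (fun x hx => h.variation_of_constants (neg_sq κ) hf hx) hx
  rw [neg_neg] at h2
  have h3 : 2 * (‖κ‖ * ‖y x‖) ≤ ‖dy x + κ * y x‖ + ‖dy x + -κ * y x‖ := by
    refine le_trans (le_of_eq ?_) (norm_sub_le _ _)
    rw [← norm_mul, show (2 : ℝ) = ‖(2 : ℂ)‖ by simp, ← norm_mul]
    ring_nf
  nlinarith [norm_nonneg (1 - Complex.exp κ)]

/-- The solvability condition at resonance: the source has no e^{κx} component. -/
theorem expPrimitive_one (h : IsPeriodicSolution (fun x => f x + c * y x) y dy)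
    (hc : κ ^ 2 = c) (hf : IntervalIntegrable f volume 0 1) (he : Complex.exp κ = 1) :
    expPrimitive κ f 1 = 0 := by
  have := h.variation_of_constants hc hf one_mem_Icc01
  have hκ' : Complex.exp (-κ) = 1 := by rw [Complex.exp_neg, he, inv_one]
  simpa [h.periodic, h.periodic_deriv, hκ'] using this

end IsPeriodicSolution

/-! ### The Green operator at resonance, e^κ = 1. -/

@[simp]
theorem expPrimitive_zero (κ : ℂ) (f : ℝ → ℂ) : expPrimitive κ f 0 = 0 := by
  simp [expPrimitive]

theorem continuousOn_expPrimitive {κ : ℂ} {f : ℝ → ℂ} (hf : IntervalIntegrable f volume 0 1) :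
    ContinuousOn (expPrimitive κ f) (Icc 0 1) := by
  have := (absolutelyContinuousOnInterval_integral
    (intervalIntegrable_cexp_mul hf (-κ))).continuousOn
  rwa [uIcc_of_le zero_le_one] at this

theorem intervalIntegrable_expPrimitive {κ : ℂ} {f : ℝ → ℂ}
    (hf : IntervalIntegrable f volume 0 1) : IntervalIntegrable (expPrimitive κ f) volume 0 1 :=
  (continuousOn_expPrimitive hf).intervalIntegrable_of_Icc zero_le_one

theorem norm_expPrimitive_le {κ : ℂ} {f : ℝ → ℂ} (hf : IntervalIntegrable f volume 0 1)
    (hκ : κ.re = 0) {x : ℝ} (hx : x ∈ Icc (0 : ℝ) 1) :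
    ‖expPrimitive κ f x‖ ≤ ∫ t in (0 : ℝ)..1, ‖f t‖ := by
  simpa [expPrimitive] using norm_exp_mul_integral_le (κ := κ) (s := 0) hf zero_mem_Icc01 hx hx.1
    (by simp [hκ])

theorem norm_integral_expPrimitive_le {κ : ℂ} {f : ℝ → ℂ} (hf : IntervalIntegrable f volume 0 1)
    (hκ : κ.re = 0) :
    ‖∫ r in (0 : ℝ)..1, expPrimitive κ f r‖ ≤ ∫ t in (0 : ℝ)..1, ‖f t‖ := by
  have := intervalIntegral.norm_integral_le_of_norm_le_const (a := (0 : ℝ)) (b := 1)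
    (f := expPrimitive κ f) (C := ∫ t in (0 : ℝ)..1, ‖f t‖) (fun x hx => by
      rw [uIoc_of_le zero_le_one] at hx
      exact norm_expPrimitive_le hf hκ ⟨hx.1.le, hx.2⟩)
  simpa using this

/-- The solution of `a' = κ a + f` with `∫₀¹ e^{-κx} a(x) dx = 0`. -/
noncomputable def greenAux (κ : ℂ) (f : ℝ → ℂ) (x : ℝ) : ℂ :=
  Complex.exp (κ * x) * (expPrimitive κ f x - ∫ r in (0 : ℝ)..1, expPrimitive κ f r)

/-- The periodic solution of `y'' = f + κ² y` orthogonal to `e^{±κx}`. -/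
noncomputable def green (κ : ℂ) (f : ℝ → ℂ) (x : ℝ) : ℂ :=
  (greenAux κ f x - greenAux (-κ) f x) / (2 * κ)

theorem green_neg (κ : ℂ) (f : ℝ → ℂ) : green (-κ) f = green κ f := by
  ext x
  simp only [green, neg_neg]
  rw [show 2 * -κ = -(2 * κ) by ring, div_neg, ← neg_div, neg_sub]

theorem norm_greenAux_le {κ : ℂ} {f : ℝ → ℂ} (hf : IntervalIntegrable f volume 0 1)
    (hκ : κ.re = 0) {x : ℝ} (hx : x ∈ Icc (0 : ℝ) 1) :
    ‖greenAux κ f x‖ ≤ 2 * ∫ t in (0 : ℝ)..1, ‖f t‖ := by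
  rw [greenAux, norm_mul, norm_exp_mul_of_re_eq_zero hκ, one_mul, two_mul]
  exact (norm_sub_le _ _).trans
    (add_le_add (norm_expPrimitive_le hf hκ hx) (norm_integral_expPrimitive_le hf hκ))

theorem norm_green_le {κ : ℂ} {f : ℝ → ℂ} (hf : IntervalIntegrable f volume 0 1)
    (hκ : κ.re = 0) {x : ℝ} (hx : x ∈ Icc (0 : ℝ) 1) :
    ‖green κ f x‖ ≤ 2 * (∫ t in (0 : ℝ)..1, ‖f t‖) / ‖κ‖ := by
  have h1 := norm_greenAux_le hf hκ hx
  have h2 := norm_greenAux_le (κ := -κ) hf (by simpa) hx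
  rw [green, norm_div, norm_mul, Complex.norm_ofNat, ← div_div]
  gcongr
  linarith [norm_sub_le (greenAux κ f x) (greenAux (-κ) f x)]

theorem expPrimitive_sub {κ : ℂ} {f g : ℝ → ℂ} (hf : IntervalIntegrable f volume 0 1)
    (hg : IntervalIntegrable g volume 0 1) {x : ℝ} (hx : x ∈ Icc (0 : ℝ) 1) :
    expPrimitive κ (f - g) x = expPrimitive κ f x - expPrimitive κ g x := by
  simp only [expPrimitive, Pi.sub_apply, mul_sub]
  exact intervalIntegral.integral_sub
    (intervalIntegrable_of_mem (intervalIntegrable_cexp_mul hf _) zero_mem_Icc01 hx)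
    (intervalIntegrable_of_mem (intervalIntegrable_cexp_mul hg _) zero_mem_Icc01 hx)

theorem greenAux_sub {κ : ℂ} {f g : ℝ → ℂ} (hf : IntervalIntegrable f volume 0 1)
    (hg : IntervalIntegrable g volume 0 1) {x : ℝ} (hx : x ∈ Icc (0 : ℝ) 1) :
    greenAux κ (f - g) x = greenAux κ f x - greenAux κ g x := by
  have : ∫ r in (0 : ℝ)..1, expPrimitive κ (f - g) r =
      (∫ r in (0 : ℝ)..1, expPrimitive κ f r) - ∫ r in (0 : ℝ)..1, expPrimitive κ g r := by
    rw [← intervalIntegral.integral_sub (intervalIntegrable_expPrimitive hf)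
      (intervalIntegrable_expPrimitive hg)]
    apply intervalIntegral.integral_congr
    intro r hr
    rw [uIcc_of_le zero_le_one] at hr
    exact expPrimitive_sub hf hg hr
  simp only [greenAux, this, expPrimitive_sub hf hg hx]
  ring

theorem green_sub {κ : ℂ} {f g : ℝ → ℂ} (hf : IntervalIntegrable f volume 0 1)
    (hg : IntervalIntegrable g volume 0 1) {x : ℝ} (hx : x ∈ Icc (0 : ℝ) 1) :
    green κ (f - g) x = green κ f x - green κ g x := by
  simp only [green, greenAux_sub hf hg hx]
  ring

theorem absolutelyContinuousOnInterval_greenAux {κ : ℂ} {f : ℝ → ℂ}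
    (hf : IntervalIntegrable f volume 0 1) : AbsolutelyContinuousOnInterval (greenAux κ f) 0 1 := by
  have h1 := (absolutelyContinuousOnInterval_integral (intervalIntegrable_cexp_mul hf (-κ)))
  have h2 : AbsolutelyContinuousOnInterval
      (fun _ : ℝ => ∫ r in (0 : ℝ)..1, expPrimitive κ f r) 0 1 :=
    contDiff_const.contDiffOn.absolutelyContinuousOnInterval
  exact (absolutelyContinuousOnInterval_cexp_mul κ).smul (h1.sub h2)

theorem ae_hasDerivAt_greenAux {κ : ℂ} {f : ℝ → ℂ} (hf : IntervalIntegrable f volume 0 1) :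
    ∀ᵐ x ∂vol01, HasDerivAt (greenAux κ f) (κ * greenAux κ f x + f x) x := by
  rw [ae_vol01_iff]
  filter_upwards [(intervalIntegrable_cexp_mul hf (-κ)).ae_hasDerivAt_integral] with x hx hx'
  have h1 := hx (by rwa [uIcc_of_le zero_le_one]) 0 (by simp)
  refine ((hasDerivAt_cexp_mul κ x).mul
    (h1.sub_const (∫ r in (0 : ℝ)..1, expPrimitive κ f r))).congr_deriv ?_
  rw [← mul_assoc (Complex.exp (κ * x)), exp_mul_exp_neg, greenAux, expPrimitive]
  ring

theorem continuousOn_greenAux {κ : ℂ} {f : ℝ → ℂ} (hf : IntervalIntegrable f volume 0 1) :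
    ContinuousOn (greenAux κ f) (Icc 0 1) := by
  simpa using (absolutelyContinuousOnInterval_greenAux (κ := κ) hf).continuousOn

theorem continuousOn_green {κ : ℂ} {f : ℝ → ℂ} (hf : IntervalIntegrable f volume 0 1) :
    ContinuousOn (green κ f) (Icc 0 1) :=
  ((continuousOn_greenAux hf).sub (continuousOn_greenAux hf)).div_const _

/-- The two vanishing coefficients are what makes `greenAux` periodic for κ and -κ; then y' is the
half-sum and κy the half-difference of these functions. -/
theorem isPeriodicSolution_green {κ : ℂ} {f : ℝ → ℂ} (hf : IntervalIntegrable f volume 0 1)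
    (hκ : κ ≠ 0) (he : Complex.exp κ = 1) (h1 : expPrimitive κ f 1 = 0)
    (h2 : expPrimitive (-κ) f 1 = 0) :
    IsPeriodicSolution (fun x => f x + κ ^ 2 * green κ f x) (green κ f)
      (fun x => (greenAux κ f x + greenAux (-κ) f x) / 2) := by
  have he' : Complex.exp (-κ) = 1 := by rw [Complex.exp_neg, he, inv_one]
  have hc : ContinuousOn (fun x => (greenAux κ f x + greenAux (-κ) f x) / 2) (Icc 0 1) :=
    ((continuousOn_greenAux hf).add (continuousOn_greenAux hf)).div_const _
  have p1 : greenAux κ f 1 = greenAux κ f 0 := by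
    simp [greenAux, h1, he]
  have p2 : greenAux (-κ) f 1 = greenAux (-κ) f 0 := by
    simp [greenAux, h2, he']
  refine ⟨fun x hx => hasDerivWithinAt_of_eq_add_integral hc (fun x hx => ?_) hx, ?_, ?_, ?_, ?_⟩
  · have hac := ((absolutelyContinuousOnInterval_greenAux (κ := κ) hf).sub
      (absolutelyContinuousOnInterval_greenAux (κ := -κ) hf)).const_smul (2 * κ)⁻¹
    have := hac.eq_add_integral (hc.intervalIntegrable_of_Icc zero_le_one) (by
      filter_upwards [ae_hasDerivAt_greenAux (κ := κ) hf,
        ae_hasDerivAt_greenAux (κ := -κ) hf] with t k1 k2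
      refine ((k1.sub k2).const_mul (2 * κ)⁻¹).congr_deriv ?_
      field_simp
      ring) hx
    simpa [green, div_eq_inv_mul] using this
  · have hac := ((absolutelyContinuousOnInterval_greenAux (κ := κ) hf).add
      (absolutelyContinuousOnInterval_greenAux (κ := -κ) hf)).const_smul (2 : ℂ)⁻¹
    simpa [div_eq_inv_mul] using hac
  · filter_upwards [ae_hasDerivAt_greenAux (κ := κ) hf,
      ae_hasDerivAt_greenAux (κ := -κ) hf] with t k1 k2
    refine ((k1.add k2).div_const 2).congr_deriv ?_
    rw [green]
    field_simp
    ring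
  · simp [green, p1, p2]
  · simp [p1, p2]

theorem integral_exp_mul_greenAux {κ : ℂ} {f : ℝ → ℂ} (hf : IntervalIntegrable f volume 0 1) :
    ∫ x in (0 : ℝ)..1, Complex.exp (-κ * x) * greenAux κ f x = 0 := by
  have : ∀ x : ℝ, Complex.exp (-κ * x) * greenAux κ f x =
      expPrimitive κ f x - ∫ r in (0 : ℝ)..1, expPrimitive κ f r := fun x => by
    rw [greenAux, ← mul_assoc, mul_comm (Complex.exp _), exp_mul_exp_neg, one_mul]
  simp_rw [this]
  rw [intervalIntegral.integral_sub (intervalIntegrable_expPrimitive hf) (by simp)]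
  simp

/-- Here y' + κy is `greenAux κ f`, whose e^{κx} coefficient was removed by subtracting the mean, so
`integral_exp_mul` transfers the orthogonality to y. -/
theorem integral_exp_mul_green {κ : ℂ} {f : ℝ → ℂ} (hf : IntervalIntegrable f volume 0 1)
    (hκ : κ ≠ 0) (he : Complex.exp κ = 1) (h1 : expPrimitive κ f 1 = 0)
    (h2 : expPrimitive (-κ) f 1 = 0) :
    ∫ x in (0 : ℝ)..1, Complex.exp (-κ * x) * green κ f x = 0 := by
  have h := (isPeriodicSolution_green hf hκ he h1 h2).integral_exp_mul he
  have h3 : ∀ x : ℝ, (greenAux κ f x + greenAux (-κ) f x) / 2 + κ * green κ f x =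
      greenAux κ f x := fun x => by
    rw [green]; field_simp; ring
  simp_rw [h3] at h
  rw [integral_exp_mul_greenAux hf] at h
  simpa [hκ] using h.symm

/-- A priori bound for a periodic solution of `y'' = f + κ² y` orthogonal to `e^{±κx}`. -/
theorem IsPeriodicSolution.norm_mul_le_of_orthogonal {κ : ℂ} {f y dy : ℝ → ℂ}
    (h : IsPeriodicSolution (fun x => f x + κ ^ 2 * y x) y dy) (hκ : κ.re = 0)
    (hf : IntervalIntegrable f volume 0 1) (he : Complex.exp κ = 1)
    (o1 : ∫ x in (0 : ℝ)..1, Complex.exp (-κ * x) * y x = 0)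
    (o2 : ∫ x in (0 : ℝ)..1, Complex.exp (κ * x) * y x = 0) {x : ℝ} (hx : x ∈ Icc (0 : ℝ) 1) :
    ‖κ‖ * ‖y x‖ ≤ 2 * ∫ t in (0 : ℝ)..1, ‖f t‖ := by
  have key : ∀ κ' : ℂ, κ' ^ 2 = κ ^ 2 → κ'.re = 0 → Complex.exp κ' = 1 →
      ∫ x in (0 : ℝ)..1, Complex.exp (-κ' * x) * y x = 0 →
      ‖dy x + κ' * y x‖ ≤ 2 * ∫ t in (0 : ℝ)..1, ‖f t‖ := by
    intro κ' k1 k2 k3 k4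
    have hr : ∀ x ∈ Icc (0 : ℝ) 1, _ := fun x hx => h.variation_of_constants k1 hf hx
    have h1 := h.integral_exp_mul k3
    -- Orthogonality determines the free constant: y'(0) + κ'y(0) is minus the mean of the primitive
    -- of the source.
    rw [k4, mul_zero, intervalIntegral.integral_congr (g := fun x =>
      (dy 0 + κ' * y 0) + expPrimitive κ' f x) (fun x hx => hr x (by simpa using hx)),
      intervalIntegral.integral_add (by simp) (intervalIntegrable_expPrimitive hf)] at h1
    simp only [intervalIntegral.integral_const, sub_zero, one_smul] at h1
    have h2 : ‖dy x + κ' * y x‖ = ‖(dy 0 + κ' * y 0) + expPrimitive κ' f x‖ := by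
      rw [← hr x hx, norm_mul, norm_exp_mul_of_re_eq_zero (by simpa), one_mul]
    rw [h2, eq_neg_of_add_eq_zero_left h1, two_mul]
    refine (norm_add_le _ _).trans (add_le_add ?_ (norm_expPrimitive_le hf k2 hx))
    rw [norm_neg]
    exact norm_integral_expPrimitive_le hf k2
  have k1 := key κ rfl hκ he o1
  have k2 := key (-κ) (neg_sq κ) (by simpa) (by rw [Complex.exp_neg, he, inv_one])
    (by simpa using o2)
  have h3 : 2 * (‖κ‖ * ‖y x‖) ≤ ‖dy x + κ * y x‖ + ‖dy x + -κ * y x‖ := by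
    refine le_trans (le_of_eq ?_) (norm_sub_le _ _)
    rw [← norm_mul, show (2 : ℝ) = ‖(2 : ℂ)‖ by simp, ← norm_mul]
    ring_nf
  linarith

theorem IsPeriodicSolution.add {f g y dy z dz : ℝ → ℂ} (h : IsPeriodicSolution f y dy)
    (h' : IsPeriodicSolution g z dz) :
    IsPeriodicSolution (fun x => f x + g x) (fun x => y x + z x) (fun x => dy x + dz x) := by
  refine ⟨fun x hx => (h.1 x hx).add (h'.1 x hx), h.2.add h'.2, ?_, ?_, ?_⟩
  · filter_upwards [h.3, h'.3] with x h1 h2 using h1.add h2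
  · simp [h.periodic, h'.periodic]
  · simp [h.periodic_deriv, h'.periodic_deriv]

theorem IsPeriodicSolution.congr_fun {f y z dy : ℝ → ℂ} (h : IsPeriodicSolution f y dy)
    (hz : ∀ x ∈ Icc (0 : ℝ) 1, z x = y x) : IsPeriodicSolution f z dy :=
  ⟨fun x hx => (h.1 x hx).congr hz (hz x hx), h.2, h.3,
    by rw [hz 1 one_mem_Icc01, hz 0 zero_mem_Icc01, h.periodic], h.5⟩

/-! ### Projection onto the exponentials e^{±κx}. -/

/-- The exponents `±κ`. -/
def expo (κ : ℂ) (k : Fin 2) : ℂ := ![κ, -κ] k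

/-- The exponentials `e^{±κx}`. -/
noncomputable def wave (κ : ℂ) (k : Fin 2) (x : ℝ) : ℂ := Complex.exp (expo κ k * x)

/-- The coefficient `∫₀¹ e^{∓κt} f(t) dt`. -/
noncomputable def coef (κ : ℂ) (k : Fin 2) (f : ℝ → ℂ) : ℂ := expPrimitive (expo κ k) f 1

theorem expo_sq (κ : ℂ) (k : Fin 2) : expo κ k ^ 2 = κ ^ 2 := by
  fin_cases k <;> simp [expo]

theorem expo_re {κ : ℂ} (hκ : κ.re = 0) (k : Fin 2) : (expo κ k).re = 0 := by
  fin_cases k <;> simp [expo, hκ]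

theorem expo_ne_zero {κ : ℂ} (hκ : κ ≠ 0) (k : Fin 2) : expo κ k ≠ 0 := by
  fin_cases k <;> simp [expo, hκ]

theorem exp_expo {κ : ℂ} (he : Complex.exp κ = 1) (k : Fin 2) : Complex.exp (expo κ k) = 1 := by
  fin_cases k <;> simp [expo, he, Complex.exp_neg]

theorem green_expo (κ : ℂ) (f : ℝ → ℂ) (k : Fin 2) : green (expo κ k) f = green κ f := by
  fin_cases k <;> simp [expo, green_neg]

theorem norm_wave {κ : ℂ} (hκ : κ.re = 0) (k : Fin 2) (x : ℝ) : ‖wave κ k x‖ = 1 :=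
  norm_exp_mul_of_re_eq_zero (expo_re hκ k) x

theorem continuous_wave (κ : ℂ) (k : Fin 2) : Continuous (wave κ k) := continuous_cexp_mul _

theorem isPeriodicSolution_wave {κ : ℂ} (he : Complex.exp κ = 1) (k : Fin 2) :
    IsPeriodicSolution (fun x => κ ^ 2 * wave κ k x) (wave κ k)
      (fun x => expo κ k * wave κ k x) := by
  have hd := hasDerivAt_cexp_mul (expo κ k)
  have h1 : wave κ k 1 = wave κ k 0 := by simp [wave, exp_expo he]
  refine ⟨fun x _ => (hd x).hasDerivWithinAt,
    (absolutelyContinuousOnInterval_cexp_mul _).const_smul (expo κ k),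
    Filter.Eventually.of_forall fun x => ((hd x).const_mul _).congr_deriv ?_, h1, by simp [h1]⟩
  rw [← mul_assoc, ← sq, expo_sq]
  rfl

theorem coef_wave {κ : ℂ} (hκ : κ ≠ 0) (he : Complex.exp κ = 1) (k j : Fin 2) :
    coef κ k (wave κ j) = if k = j then 1 else 0 := by
  have h0 : ∀ c : ℂ, c ≠ 0 → Complex.exp c = 1 → ∫ t in (0 : ℝ)..1, Complex.exp (c * t) = 0 := by
    intro c hc h
    rw [integral_exp_mul_complex hc]
    simp [h]
  have h1 : coef κ k (wave κ j) =
      ∫ t in (0 : ℝ)..1, Complex.exp ((expo κ j - expo κ k) * t) := by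
    simp only [coef, expPrimitive, wave, ← Complex.exp_add]
    congr 1 with t
    ring_nf
  rw [h1]
  have e2 : Complex.exp (κ + κ) = 1 := by rw [Complex.exp_add, he, one_mul]
  have n2 : κ + κ ≠ 0 := by rw [← two_mul]; simpa
  fin_cases k <;> fin_cases j
  · simp
  · simpa [expo] using h0 (-κ - κ) (by rw [← neg_add']; simpa using n2) (by
      rw [← neg_add', Complex.exp_neg, e2, inv_one])
  · simpa [expo] using h0 (κ + κ) n2 e2
  · simp

theorem norm_coef_le {κ : ℂ} (hκ : κ.re = 0) {f : ℝ → ℂ} (hf : IntervalIntegrable f volume 0 1)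
    (k : Fin 2) : ‖coef κ k f‖ ≤ ∫ t in (0 : ℝ)..1, ‖f t‖ :=
  norm_expPrimitive_le hf (expo_re hκ k) one_mem_Icc01

theorem coef_sub {κ : ℂ} {f g : ℝ → ℂ} (hf : IntervalIntegrable f volume 0 1)
    (hg : IntervalIntegrable g volume 0 1) (k : Fin 2) :
    coef κ k (f - g) = coef κ k f - coef κ k g :=
  expPrimitive_sub hf hg one_mem_Icc01

theorem coef_const_mul (κ c : ℂ) (f : ℝ → ℂ) (k : Fin 2) :
    coef κ k (fun t => c * f t) = c * coef κ k f := by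
  rw [coef, coef, expPrimitive, expPrimitive, ← intervalIntegral.integral_const_mul]
  congr 1 with t
  ring

theorem intervalIntegrable_sum_mul {f : Fin 2 → ℝ → ℂ} (c : Fin 2 → ℂ)
    (hf : ∀ k, IntervalIntegrable (f k) volume 0 1) :
    IntervalIntegrable (fun t => ∑ k, c k * f k t) volume 0 1 := by
  simpa only [Fin.sum_univ_two] using ((hf 0).const_mul (c 0)).add ((hf 1).const_mul (c 1))

theorem coef_sum_mul {κ : ℂ} {f : Fin 2 → ℝ → ℂ} (c : Fin 2 → ℂ)
    (hf : ∀ k, IntervalIntegrable (f k) volume 0 1) (k : Fin 2) :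
    coef κ k (fun t => ∑ l, c l * f l t) = ∑ l, c l * coef κ k (f l) := by
  simp only [Fin.sum_univ_two, ← coef_const_mul]
  rw [coef, coef, coef, expPrimitive, expPrimitive, expPrimitive,
    ← intervalIntegral.integral_add (intervalIntegrable_cexp_mul ((hf 0).const_mul _) _)
    (intervalIntegrable_cexp_mul ((hf 1).const_mul _) _)]
  congr 1 with t
  ring

theorem intervalIntegrable_wave (κ : ℂ) (k : Fin 2) :
    IntervalIntegrable (wave κ k) volume 0 1 := (continuous_wave κ k).intervalIntegrable _ _

/-- The component of `f` orthogonal to `e^{±κx}`. -/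
noncomputable def perp (κ : ℂ) (f : ℝ → ℂ) : ℝ → ℂ :=
  f - fun x => ∑ k, coef κ k f * wave κ k x

theorem intervalIntegrable_perp {κ : ℂ} {f : ℝ → ℂ} (hf : IntervalIntegrable f volume 0 1) :
    IntervalIntegrable (perp κ f) volume 0 1 :=
  hf.sub (intervalIntegrable_sum_mul _ (intervalIntegrable_wave κ))

theorem coef_perp {κ : ℂ} (hκ : κ ≠ 0) (he : Complex.exp κ = 1) {f : ℝ → ℂ}
    (hf : IntervalIntegrable f volume 0 1) (k : Fin 2) : coef κ k (perp κ f) = 0 := by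
  rw [perp, coef_sub hf (intervalIntegrable_sum_mul _ (intervalIntegrable_wave κ)),
    coef_sum_mul _ (intervalIntegrable_wave κ)]
  simp [coef_wave hκ he]

theorem perp_sub {κ : ℂ} {f g : ℝ → ℂ} (hf : IntervalIntegrable f volume 0 1)
    (hg : IntervalIntegrable g volume 0 1) : perp κ (f - g) = perp κ f - perp κ g := by
  ext x
  simp only [perp, Pi.sub_apply, coef_sub hf hg, sub_mul, Finset.sum_sub_distrib]
  ring

theorem integral_norm_le_of_le {q f : ℝ → ℂ} (hq : IntervalIntegrable q volume 0 1)
    (hf : IntervalIntegrable f volume 0 1) {a b : ℝ}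
    (h : ∀ t ∈ Icc (0 : ℝ) 1, ‖f t‖ ≤ ‖q t‖ * a + b) :
    ∫ t in (0 : ℝ)..1, ‖f t‖ ≤ (∫ t in (0 : ℝ)..1, ‖q t‖) * a + b := by
  have h1 : IntervalIntegrable (fun t => ‖q t‖ * a) volume 0 1 := hq.norm.mul_const a
  have h2 : IntervalIntegrable (fun _ : ℝ => b) volume 0 1 := by simp
  refine (intervalIntegral.integral_mono_on zero_le_one hf.norm (h1.add h2) h).trans_eq ?_
  rw [intervalIntegral.integral_add h1 h2, intervalIntegral.integral_mul_const]
  simp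

theorem integral_norm_perp_le {κ : ℂ} (hκ : κ.re = 0) {f : ℝ → ℂ}
    (hf : IntervalIntegrable f volume 0 1) :
    ∫ t in (0 : ℝ)..1, ‖perp κ f t‖ ≤ 3 * ∫ t in (0 : ℝ)..1, ‖f t‖ := by
  refine (integral_norm_le_of_le hf (intervalIntegrable_perp hf) (a := 1)
    (b := 2 * ∫ t in (0 : ℝ)..1, ‖f t‖) fun t _ => ?_).trans_eq (by ring)
  rw [perp, Pi.sub_apply, mul_one, Fin.sum_univ_two, two_mul]
  refine (norm_sub_le _ _).trans (add_le_add le_rfl ((norm_add_le _ _).trans ?_))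
  simp only [norm_mul, norm_wave hκ, mul_one]
  exact add_le_add (norm_coef_le hκ hf 0) (norm_coef_le hκ hf 1)

theorem norm_green_perp_le {κ : ℂ} (hκ : κ.re = 0) {f : ℝ → ℂ}
    (hf : IntervalIntegrable f volume 0 1) {b : ℝ} (hb : ∫ t in (0 : ℝ)..1, ‖f t‖ ≤ b)
    {x : ℝ} (hx : x ∈ Icc (0 : ℝ) 1) : ‖green κ (perp κ f) x‖ ≤ 6 * b / ‖κ‖ := by
  refine (norm_green_le (intervalIntegrable_perp hf) hκ hx).trans ?_
  refine div_le_div_of_nonneg_right ?_ (norm_nonneg κ)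
  linarith [integral_norm_perp_le hκ hf]

/-! ### The Riccati equation for the deformed exponentials. -/

/-- The constant extension to `ℝ` of a continuous function on `[0,1]`. -/
noncomputable def extendIcc (X : C(Icc (0 : ℝ) 1, ℂ)) : ℝ → ℂ := IccExtend zero_le_one X

theorem continuous_extendIcc (X : C(Icc (0 : ℝ) 1, ℂ)) : Continuous (extendIcc X) :=
  X.continuous.Icc_extend'

theorem norm_extendIcc_le (X : Fin 2 → C(Icc (0 : ℝ) 1, ℂ)) (j : Fin 2) (t : ℝ) :
    ‖extendIcc (X j) t‖ ≤ ‖X‖ :=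
  ((X j).norm_coe_le_norm _).trans (norm_le_pi_norm X j)

theorem extendIcc_sub (X Y : Fin 2 → C(Icc (0 : ℝ) 1, ℂ)) (j : Fin 2) (t : ℝ) :
    extendIcc ((X - Y) j) t = extendIcc (X j) t - extendIcc (Y j) t := rfl

/-- The matrix of the perturbation on the perturbed exponentials `e^{±κx} + X`. -/
noncomputable def perturbMatrix (q : ℝ → ℂ) (κ : ℂ) (X : Fin 2 → C(Icc (0 : ℝ) 1, ℂ)) :
    Matrix (Fin 2) (Fin 2) ℂ :=
  Matrix.of fun k j => coef κ k fun t => q t * (wave κ j t + extendIcc (X j) t)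

/-- The right-hand side of the Riccati equation for `X`. -/
noncomputable def riccatiSource (q : ℝ → ℂ) (κ : ℂ) (X : Fin 2 → C(Icc (0 : ℝ) 1, ℂ)) (j : Fin 2)
    (t : ℝ) : ℂ :=
  q t * (wave κ j t + extendIcc (X j) t) - ∑ k, perturbMatrix q κ X k j * extendIcc (X k) t

section riccati
variable {q : ℝ → ℂ} {κ : ℂ} (hq : IntervalIntegrable q volume 0 1)
  (X Y : Fin 2 → C(Icc (0 : ℝ) 1, ℂ)) (j k : Fin 2)
include hq

theorem intervalIntegrable_mul_wave_add :
    IntervalIntegrable (fun t => q t * (wave κ j t + extendIcc (X j) t)) volume 0 1 :=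
  hq.mul_continuousOn ((continuous_wave κ j).add (continuous_extendIcc _)).continuousOn

theorem intervalIntegrable_riccatiSource :
    IntervalIntegrable (riccatiSource q κ X j) volume 0 1 :=
  (intervalIntegrable_mul_wave_add hq X j).sub (intervalIntegrable_sum_mul _ fun k =>
    (continuous_extendIcc (X k)).intervalIntegrable _ _)

theorem norm_perturbMatrix_le (hκ : κ.re = 0) (hX : ‖X‖ ≤ 1) :
    ‖perturbMatrix q κ X k j‖ ≤ (∫ t in (0 : ℝ)..1, ‖q t‖) * 2 := by
  have hi := intervalIntegrable_mul_wave_add (κ := κ) hq X j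
  refine (norm_coef_le hκ hi k).trans ?_
  refine (integral_norm_le_of_le hq hi (a := 2) (b := 0) fun t _ => ?_).trans_eq (add_zero _)
  rw [norm_mul, add_zero]
  gcongr
  refine (norm_add_le _ _).trans ?_
  rw [norm_wave hκ]
  linarith [norm_extendIcc_le X j t]

theorem norm_perturbMatrix_sub_le (hκ : κ.re = 0) :
    ‖perturbMatrix q κ X k j - perturbMatrix q κ Y k j‖ ≤
      (∫ t in (0 : ℝ)..1, ‖q t‖) * ‖X - Y‖ := by
  have hi := intervalIntegrable_mul_wave_add (κ := κ) hq X j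
  have hi' := intervalIntegrable_mul_wave_add (κ := κ) hq Y j
  simp only [perturbMatrix, Matrix.of_apply]
  rw [← coef_sub hi hi']
  refine (norm_coef_le hκ (hi.sub hi') k).trans ?_
  refine (integral_norm_le_of_le hq (hi.sub hi') (a := ‖X - Y‖) (b := 0)
    fun t _ => ?_).trans_eq (add_zero _)
  rw [← mul_sub, add_sub_add_left_eq_sub, norm_mul, add_zero, ← extendIcc_sub]
  gcongr
  exact norm_extendIcc_le _ _ _

theorem integral_norm_riccatiSource_le (hκ : κ.re = 0) (hX : ‖X‖ ≤ 1) :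
    ∫ t in (0 : ℝ)..1, ‖riccatiSource q κ X j t‖ ≤ 6 * ∫ t in (0 : ℝ)..1, ‖q t‖ := by
  refine (integral_norm_le_of_le hq (intervalIntegrable_riccatiSource hq X j) (a := 2)
    (b := 4 * ∫ t in (0 : ℝ)..1, ‖q t‖) fun t _ => ?_).trans_eq (by ring)
  have hB : ∀ k, ‖perturbMatrix q κ X k j * extendIcc (X k) t‖ ≤
      (∫ t in (0 : ℝ)..1, ‖q t‖) * 2 := fun k => by
    rw [norm_mul]
    exact (mul_le_of_le_one_right (norm_nonneg _) ((norm_extendIcc_le X k t).trans hX)).trans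
      (norm_perturbMatrix_le hq X j k hκ hX)
  refine (norm_sub_le _ _).trans (add_le_add ?_ ?_)
  · rw [norm_mul]
    gcongr
    refine (norm_add_le _ _).trans ?_
    rw [norm_wave hκ]
    linarith [norm_extendIcc_le X j t]
  · rw [Fin.sum_univ_two]
    linarith [norm_add_le (perturbMatrix q κ X 0 j * extendIcc (X 0) t)
      (perturbMatrix q κ X 1 j * extendIcc (X 1) t), hB 0, hB 1]

theorem integral_norm_riccatiSource_sub_le (hκ : κ.re = 0) (hX : ‖X‖ ≤ 1) (hY : ‖Y‖ ≤ 1) :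
    ∫ t in (0 : ℝ)..1, ‖(riccatiSource q κ X j - riccatiSource q κ Y j) t‖ ≤
      7 * (∫ t in (0 : ℝ)..1, ‖q t‖) * ‖X - Y‖ := by
  refine (integral_norm_le_of_le hq ((intervalIntegrable_riccatiSource hq X j).sub
    (intervalIntegrable_riccatiSource hq Y j)) (a := ‖X - Y‖)
    (b := 6 * (∫ t in (0 : ℝ)..1, ‖q t‖) * ‖X - Y‖) fun t _ => ?_).trans_eq (by ring)
  have hB : ∀ k, ‖perturbMatrix q κ X k j * extendIcc (X k) t -
      perturbMatrix q κ Y k j * extendIcc (Y k) t‖ ≤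
      3 * (∫ t in (0 : ℝ)..1, ‖q t‖) * ‖X - Y‖ := fun k => by
    have e : perturbMatrix q κ X k j * extendIcc (X k) t -
        perturbMatrix q κ Y k j * extendIcc (Y k) t =
        (perturbMatrix q κ X k j - perturbMatrix q κ Y k j) * extendIcc (X k) t +
        perturbMatrix q κ Y k j * extendIcc ((X - Y) k) t := by rw [extendIcc_sub]; ring
    rw [e]
    refine (norm_add_le _ _).trans ?_
    rw [norm_mul, norm_mul]
    have h1 := mul_le_mul (norm_perturbMatrix_sub_le hq X Y j k hκ)
      ((norm_extendIcc_le X k t).trans hX) (norm_nonneg _) ((norm_nonneg _).trans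
        (norm_perturbMatrix_sub_le hq X Y j k hκ))
    have h2 := mul_le_mul (norm_perturbMatrix_le hq Y j k hκ hY)
      (norm_extendIcc_le (X - Y) k t) (norm_nonneg _) ((norm_nonneg _).trans
        (norm_perturbMatrix_le hq Y j k hκ hY))
    linarith
  have e : riccatiSource q κ X j t - riccatiSource q κ Y j t =
      q t * extendIcc ((X - Y) j) t - ∑ k, (perturbMatrix q κ X k j * extendIcc (X k) t -
      perturbMatrix q κ Y k j * extendIcc (Y k) t) := by
    rw [extendIcc_sub]
    simp only [riccatiSource, Finset.sum_sub_distrib]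
    ring
  rw [e]
  refine (norm_sub_le _ _).trans (add_le_add ?_ ?_)
  · rw [norm_mul]
    gcongr
    exact norm_extendIcc_le _ _ _
  · rw [Fin.sum_univ_two]
    refine (norm_add_le _ _).trans ?_
    linarith [hB 0, hB 1]

/-- Banach's fixed-point theorem on the closed unit ball. The source has L¹ norm at most 6Q and
Lipschitz constant 7Q there, and the projected Green operator contributes 6/|κ|; so 36Q/|κ| bounds
the image and 42Q/|κ| ≤ 1/2 is the contraction factor, whence the 84. -/
theorem exists_riccati_solution (hκ : κ.re = 0) (hκ0 : κ ≠ 0)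
    (hbig : 84 * (∫ t in (0 : ℝ)..1, ‖q t‖) ≤ ‖κ‖) :
    ∃ X : Fin 2 → C(Icc (0 : ℝ) 1, ℂ), ‖X‖ ≤ 1 ∧
      ‖X‖ ≤ 36 * (∫ t in (0 : ℝ)..1, ‖q t‖) / ‖κ‖ ∧
      ∀ j, ∀ x ∈ Icc (0 : ℝ) 1,
        extendIcc (X j) x = green κ (perp κ (riccatiSource q κ X j)) x := by
  set Q := ∫ t in (0 : ℝ)..1, ‖q t‖ with hQ
  have hκp : 0 < ‖κ‖ := norm_pos_iff.2 hκ0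
  let T : (Fin 2 → C(Icc (0 : ℝ) 1, ℂ)) → (Fin 2 → C(Icc (0 : ℝ) 1, ℂ)) := fun X j =>
    ⟨(Icc (0 : ℝ) 1).domRestrict (green κ (perp κ (riccatiSource q κ X j))),
      (continuousOn_green (intervalIntegrable_perp
        (intervalIntegrable_riccatiSource hq X j))).domRestrict⟩
  have hQ0 : 0 ≤ Q := intervalIntegral.integral_nonneg zero_le_one fun _ _ => norm_nonneg _
  have hT : ∀ X, ‖X‖ ≤ 1 → ‖T X‖ ≤ 36 * Q / ‖κ‖ := fun X hX => by
    refine (pi_norm_le_iff_of_nonneg (by positivity)).2 fun j =>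
      (ContinuousMap.norm_le _ (by positivity)).2 fun x => ?_
    refine (norm_green_perp_le hκ (intervalIntegrable_riccatiSource hq X j)
      (integral_norm_riccatiSource_le hq X j hκ hX) x.2).trans_eq ?_
    rw [← mul_assoc, ← hQ]; norm_num
  have h1 : 36 * Q / ‖κ‖ ≤ 1 := by
    rw [div_le_one hκp]; linarith
  have hL : ∀ X Y, ‖X‖ ≤ 1 → ‖Y‖ ≤ 1 → ‖T X - T Y‖ ≤ 1 / 2 * ‖X - Y‖ := fun X Y hX hY => by
    refine (pi_norm_le_iff_of_nonneg (by positivity)).2 fun j =>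
      (ContinuousMap.norm_le _ (by positivity)).2 fun x => ?_
    have iX := intervalIntegrable_riccatiSource (κ := κ) hq X j
    have iY := intervalIntegrable_riccatiSource (κ := κ) hq Y j
    have e : (T X - T Y) j x =
        green κ (perp κ (riccatiSource q κ X j - riccatiSource q κ Y j)) x := by
      rw [perp_sub iX iY, green_sub (intervalIntegrable_perp iX) (intervalIntegrable_perp iY) x.2]
      rfl
    rw [e]
    refine (norm_green_perp_le hκ (iX.sub iY)
      (integral_norm_riccatiSource_sub_le hq X Y j hκ hX hY) x.2).trans ?_
    rw [div_le_iff₀ hκp]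
    have := norm_nonneg (X - Y)
    nlinarith
  have hmaps : MapsTo T (Metric.closedBall 0 1) (Metric.closedBall 0 1) := fun X hX => by
    rw [mem_closedBall_zero_iff] at hX ⊢
    exact (hT X hX).trans h1
  have hc : ContractingWith (1 / 2) (hmaps.restrict T _ _) := by
    refine ⟨by rw [← NNReal.coe_lt_coe]; norm_num, LipschitzWith.of_dist_le_mul fun X Y => ?_⟩
    have := hL X Y (mem_closedBall_zero_iff.1 X.2) (mem_closedBall_zero_iff.1 Y.2)
    simpa [Subtype.dist_eq, dist_eq_norm] using this
  obtain ⟨X, hX, hfix, -⟩ := hc.exists_fixedPoint' Metric.isClosed_closedBall.isComplete hmaps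
    (x := 0) (by simp) (edist_ne_top _ _)
  rw [mem_closedBall_zero_iff] at hX
  refine ⟨X, hX, ?_, fun j x hx => ?_⟩
  · conv_lhs => rw [← hfix.eq]
    exact hT X hX
  · have : extendIcc (X j) x = X j ⟨x, hx⟩ := IccExtend_of_mem _ _ hx
    rw [this]
    conv_lhs => rw [← hfix.eq]
    rfl

/-- A two-dimensional invariant subspace close to the span of `e^{±κx}`. -/
theorem exists_invariant_pair (hκ : κ.re = 0) (hκ0 : κ ≠ 0) (he : Complex.exp κ = 1)
    (hbig : 84 * (∫ t in (0 : ℝ)..1, ‖q t‖) ≤ ‖κ‖) :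
    ∃ (B : Matrix (Fin 2) (Fin 2) ℂ) (φ dφ : Fin 2 → ℝ → ℂ),
      (∀ j, Continuous (φ j)) ∧ (∀ j t, ‖φ j t‖ ≤ 2) ∧
      (∀ j, IsPeriodicSolution
        (fun x => q x * φ j x + κ ^ 2 * φ j x - ∑ k, B k j * φ k x) (φ j) (dφ j)) ∧
      (∀ k j, coef κ k (φ j) = if k = j then 1 else 0) ∧
      (∀ k j, ‖B k j - coef κ k (fun t => q t * wave κ j t)‖ ≤
        36 * (∫ t in (0 : ℝ)..1, ‖q t‖) ^ 2 / ‖κ‖) := by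
  obtain ⟨X, hX1, hX2, hX⟩ := exists_riccati_solution hq hκ hκ0 hbig
  have iS := fun j => intervalIntegrable_riccatiSource (κ := κ) hq X j
  have iP := fun j => intervalIntegrable_perp (κ := κ) (iS j)
  have iX : ∀ k, IntervalIntegrable (extendIcc (X k)) volume 0 1 := fun k =>
    (continuous_extendIcc (X k)).intervalIntegrable _ _
  have cP : ∀ j k, expPrimitive (expo κ k) (perp κ (riccatiSource q κ X j)) 1 = 0 :=
    fun j k => coef_perp hκ0 he (iS j) k
  have cX : ∀ k j, coef κ k (extendIcc (X j)) = 0 := fun k j => by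
    have h1 := integral_exp_mul_green (iP j) (expo_ne_zero hκ0 k) (exp_expo he k) (cP j k)
      (by fin_cases k
          · simpa [expo] using cP j 1
          · simpa [expo] using cP j 0)
    rw [green_expo] at h1
    rw [coef, expPrimitive, ← h1]
    apply intervalIntegral.integral_congr
    intro x hx
    rw [uIcc_of_le zero_le_one] at hx
    simp only [hX j x hx]
  have cS : ∀ k j, coef κ k (riccatiSource q κ X j) = perturbMatrix q κ X k j := fun k j => by
    have : riccatiSource q κ X j = (fun t => q t * (wave κ j t + extendIcc (X j) t)) -
      fun t => ∑ k, perturbMatrix q κ X k j * extendIcc (X k) t := rfl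
    rw [this, coef_sub (intervalIntegrable_mul_wave_add hq X j) (intervalIntegrable_sum_mul _ iX),
      coef_sum_mul _ iX]
    simp [cX, perturbMatrix]
  refine ⟨perturbMatrix q κ X, fun j t => wave κ j t + extendIcc (X j) t, fun j t =>
    expo κ j * wave κ j t + (greenAux κ (perp κ (riccatiSource q κ X j)) t +
      greenAux (-κ) (perp κ (riccatiSource q κ X j)) t) / 2, ?_, ?_, ?_, ?_, ?_⟩
  · exact fun j => (continuous_wave κ j).add (continuous_extendIcc _)
  · intro j t
    refine (norm_add_le _ _).trans ?_
    rw [norm_wave hκ]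
    linarith [norm_extendIcc_le X j t]
  · intro j
    have h1 := (isPeriodicSolution_wave he j).add
      ((isPeriodicSolution_green (iP j) hκ0 he (cP j 0) (cP j 1)).congr_fun (hX j))
    refine h1.congr ?_
    have hmem : ∀ᵐ x ∂vol01, x ∈ Icc (0 : ℝ) 1 := ae_restrict_mem measurableSet_Icc
    filter_upwards [hmem] with x hx
    rw [← hX j x hx]
    -- Since the coefficients of the source are the entries of B, removing its exponential part
    -- turns ∑ B_kj X_k into ∑ B_kj φ_k.
    simp only [perp, Pi.sub_apply, cS, riccatiSource, Fin.sum_univ_two]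
    ring
  · intro k j
    have := coef_sub (κ := κ) ((continuous_wave κ j).add
      (continuous_extendIcc (X j))|>.intervalIntegrable 0 1) (iX j) k
    rw [cX, sub_zero] at this
    rw [← coef_wave hκ0 he k j]
    refine this.symm.trans (congrArg _ ?_)
    ext t
    simp
  · intro k j
    have iw : IntervalIntegrable (fun t => q t * wave κ j t) volume 0 1 :=
      hq.mul_continuousOn (continuous_wave κ j).continuousOn
    have iqX := (intervalIntegrable_mul_wave_add (κ := κ) hq X j).sub iw
    simp only [perturbMatrix, Matrix.of_apply]
    rw [← coef_sub (intervalIntegrable_mul_wave_add hq X j) iw]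
    refine (norm_coef_le hκ iqX k).trans ?_
    refine (integral_norm_le_of_le hq iqX (a := ‖X‖) (b := 0) fun t _ => ?_).trans ?_
    · rw [← mul_sub, add_sub_cancel_left, norm_mul, add_zero]
      gcongr
      exact norm_extendIcc_le _ _ _
    · have hQ0 : 0 ≤ ∫ t in (0 : ℝ)..1, ‖q t‖ :=
        intervalIntegral.integral_nonneg zero_le_one fun _ _ => norm_nonneg _
      refine (add_zero _).trans_le ((mul_le_mul_of_nonneg_left hX2 hQ0).trans_eq ?_)
      ring
end riccati

/-! ### The operator L on L₂. -/

theorem periodicSL_iff {q : ℝ → ℂ} {u v : L2} : PeriodicSL q u v ↔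
    ∃ y dy : ℝ → ℂ, u =ᵐ[vol01] y ∧ IsPeriodicSolution (fun x => q x * y x - v x) y dy :=
  ⟨fun ⟨y, dy, h1, h2, h3, h4, h5, h6⟩ => ⟨y, dy, h1, ⟨h2, h3, h4, h5, h6⟩⟩,
    fun ⟨y, dy, h, h'⟩ => ⟨y, dy, h, h'.1, h'.2, h'.3, h'.4, h'.5⟩⟩

theorem ae_vol01_mem_Icc : ∀ᵐ x ∂vol01, x ∈ Icc (0 : ℝ) 1 := ae_restrict_mem measurableSet_Icc

instance isFiniteMeasure_vol01 : IsFiniteMeasure vol01 := by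
  unfold vol01; infer_instance

theorem intervalIntegrable_iff_vol01 {f : ℝ → ℂ} :
    IntervalIntegrable f volume 0 1 ↔ Integrable f vol01 :=
  intervalIntegrable_iff_integrableOn_Icc_of_le zero_le_one

theorem L2.intervalIntegrable (u : L2) : IntervalIntegrable u volume 0 1 :=
  intervalIntegrable_iff_vol01.2 ((Lp.memLp u).integrable (by norm_num))

theorem L2.eq_zero_of_eqOn {u : L2} {y : ℝ → ℂ} (h : u =ᵐ[vol01] y)
    (hy : ∀ x ∈ Icc (0 : ℝ) 1, y x = 0) : u = 0 := by
  apply Lp.ext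
  filter_upwards [h, Lp.coeFn_zero ℂ 2 vol01, ae_vol01_mem_Icc] with x h1 h2 h3
  rw [h1, h2, hy x h3, Pi.zero_apply]

theorem eqOn_Icc_of_ae_eq {y z : ℝ → ℂ} (h : y =ᵐ[vol01] z) (hy : ContinuousOn y (Icc 0 1))
    (hz : ContinuousOn z (Icc 0 1)) : EqOn y z (Icc 0 1) :=
  Measure.eqOn_Icc_of_ae_eq volume (by norm_num) h hy hz

/-- This makes the relation `PeriodicSL` single-valued: a continuous representative of 0 vanishes
identically, hence so do its derivatives inside the interval. -/
theorem PeriodicSL.eq_zero_of_left_eq_zero {q : ℝ → ℂ} {v : L2} (h : PeriodicSL q 0 v) :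
    v = 0 := by
  obtain ⟨y, dy, h0, h⟩ := periodicSL_iff.1 h
  have hy : EqOn y 0 (Icc 0 1) := eqOn_Icc_of_ae_eq (h0.symm.trans (Lp.coeFn_zero ℂ 2 vol01))
    h.continuousOn continuousOn_const
  have hdy : ∀ x ∈ Ioo (0 : ℝ) 1, dy x = 0 := fun x hx => by
    have h1 := hasDerivAt_of_within_Icc (h.hasDeriv x (Ioo_subset_Icc_self hx)) hx
    have h2 : y =ᶠ[nhds x] fun _ => 0 := by
      filter_upwards [Icc_mem_nhds hx.1 hx.2] with t ht using hy ht
    exact (h1.congr_of_eventuallyEq h2.symm).unique (hasDerivAt_const x 0)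
  apply Lp.ext
  filter_upwards [h.ae_hasDeriv, ae_vol01_mem_Ioo, Lp.coeFn_zero ℂ 2 vol01] with x h1 hx h3
  have h2 : dy =ᶠ[nhds x] fun _ => 0 := by
    filter_upwards [Ioo_mem_nhds hx.1 hx.2] with t ht using hdy t ht
  have h4 := (h1.congr_of_eventuallyEq h2.symm).unique (hasDerivAt_const x 0)
  rw [hy (Ioo_subset_Icc_self hx)] at h4
  rw [h3]
  simpa using h4

theorem PeriodicSL.sub {q : ℝ → ℂ} {u v u' v' : L2}
    (h : PeriodicSL q u v) (h' : PeriodicSL q u' v') : PeriodicSL q (u - u') (v - v') := by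
  have := h.add (h'.smul (-1))
  simpa [sub_eq_add_neg] using this

theorem PeriodicSL.right_unique {q : ℝ → ℂ} {u v v' : L2}
    (h : PeriodicSL q u v) (h' : PeriodicSL q u v') : v = v' := by
  have := h.sub h'
  rw [sub_self] at this
  exact sub_eq_zero.1 this.eq_zero_of_left_eq_zero

theorem exists_norm_max {y : ℝ → ℂ} (hy : ContinuousOn y (Icc 0 1)) :
    ∃ x₀ ∈ Icc (0 : ℝ) 1, ∀ x ∈ Icc (0 : ℝ) 1, ‖y x‖ ≤ ‖y x₀‖ :=
  isCompact_Icc.exists_isMaxOn ⟨0, zero_mem_Icc01⟩ hy.norm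

/-! ### Localization of the large eigenvalues. -/

theorem exists_sq_eq_re_nonpos (z : ℂ) : ∃ κ : ℂ, κ ^ 2 = z ∧ κ.re ≤ 0 := by
  obtain ⟨κ, h⟩ := IsAlgClosed.exists_pow_nat_eq z (n := 2) (by norm_num)
  rcases le_total κ.re 0 with h' | h'
  · exact ⟨κ, h, h'⟩
  · exact ⟨-κ, by rw [neg_sq, h], by simpa⟩

theorem exists_int_norm_sub_le {κ : ℂ} (h : ‖1 - Complex.exp κ‖ ≤ 1 / 2) :
    ∃ n : ℤ, ‖κ - n * (2 * π * Complex.I)‖ ≤ 3 / 2 * ‖1 - Complex.exp κ‖ := by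
  have h1 := Complex.norm_log_one_add_half_le_self (z := Complex.exp κ - 1)
    (by rwa [norm_sub_rev])
  rw [add_sub_cancel, norm_sub_rev] at h1
  obtain ⟨n, hn⟩ := Complex.exp_eq_exp_iff_exists_int.1
    (Complex.exp_log (Complex.exp_ne_zero κ)).symm
  refine ⟨n, ?_⟩
  rwa [← eq_sub_of_add_eq hn.symm]

/-- Eigenvalues of large modulus lie close to the numbers `(2πm)²`. -/
theorem exists_nat_norm_sub_le_of_periodicSL {q : ℝ → ℂ} (hq : IntervalIntegrable q volume 0 1)
    {z : ℂ} {u : L2} (hu : u ≠ 0) (h : PeriodicSL q u (z • u))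
    (hz : (4 * (∫ t in (0 : ℝ)..1, ‖q t‖) + 1) ^ 2 ≤ ‖z‖) :
    ∃ m : ℕ, ‖z - ((2 * m * π) ^ 2 : ℝ)‖ ≤ 4 * (∫ t in (0 : ℝ)..1, ‖q t‖) + 1 := by
  set Q := ∫ t in (0 : ℝ)..1, ‖q t‖ with hQ
  have hQ0 : 0 ≤ Q := intervalIntegral.integral_nonneg zero_le_one fun _ _ => norm_nonneg _
  obtain ⟨y, dy, h0, h⟩ := periodicSL_iff.1 h
  obtain ⟨κ, hκz, hκ⟩ := exists_sq_eq_re_nonpos (-z)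
  have h' : IsPeriodicSolution (fun x => q x * y x + κ ^ 2 * y x) y dy := by
    refine h.congr ?_
    filter_upwards [Lp.coeFn_smul z u, h0] with x h1 h2
    rw [h1, Pi.smul_apply, h2, hκz, smul_eq_mul]
    ring
  obtain ⟨x₀, hx₀, hmax⟩ := exists_norm_max h.continuousOn
  have hY : 0 < ‖y x₀‖ := by
    refine lt_of_le_of_ne (norm_nonneg _) fun h1 => hu (L2.eq_zero_of_eqOn h0 fun x hx => ?_)
    have := hmax x hx
    rw [← h1] at this
    simpa using this
  have hqy : IntervalIntegrable (fun x => q x * y x) volume 0 1 :=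
    hq.mul_continuousOn (by rw [uIcc_of_le zero_le_one]; exact h.continuousOn)
  have hi : ∫ t in (0 : ℝ)..1, ‖q t * y t‖ ≤ Q * ‖y x₀‖ := by
    refine (integral_norm_le_of_le hq hqy (a := ‖y x₀‖) (b := 0)
      fun t ht => ?_).trans_eq (add_zero _)
    rw [norm_mul, add_zero]
    exact mul_le_mul_of_nonneg_left (hmax t ht) (norm_nonneg _)
  set d := ‖1 - Complex.exp κ‖ with hd
  have hd0 : 0 ≤ d := norm_nonneg _
  -- The bound for periodic solutions, applied with source qy at a maximum point of |y|, after
  -- dividing by that maximum.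
  have h1 : ‖κ‖ * d ≤ Q * (1 + d) := by
    have h2 := h'.norm_mul_le hκ hqy hx₀
    have h3 : (∫ t in (0 : ℝ)..1, ‖q t * y t‖) * (1 + d) ≤ Q * ‖y x₀‖ * (1 + d) := by gcongr
    refine le_of_mul_le_mul_right (a := ‖y x₀‖) ?_ hY
    linarith
  have hκn : ‖κ‖ ^ 2 = ‖z‖ := by rw [← norm_pow, hκz, norm_neg]
  have hκb : 4 * Q + 1 ≤ ‖κ‖ := by
    rw [← hκn] at hz
    exact le_of_sq_le_sq hz (norm_nonneg _)
  have hd1 : d ≤ 1 / 3 := by nlinarith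
  obtain ⟨n, hn⟩ := exists_int_norm_sub_le (κ := κ) (by linarith)
  refine ⟨n.natAbs, ?_⟩
  have e1 : (((2 * (n.natAbs : ℝ) * π) ^ 2 : ℝ) : ℂ) = (2 * n * π) ^ 2 := by
    have h2 : ((n.natAbs : ℝ)) ^ 2 = (n : ℝ) ^ 2 := by
      rw [Nat.cast_natAbs, Int.cast_abs, sq_abs]
    rw [mul_pow, mul_pow, h2]
    push_cast
    ring
  -- With δ = κ - 2πin the difference is -δ(2κ - δ), and |δ| ≤ 3d/2 is of order Q/|κ|, so the
  -- product stays bounded: 3d|κ| + 3d/4 ≤ 4Q + 1/4.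
  have e2 : z - (((2 * (n.natAbs : ℝ) * π) ^ 2 : ℝ) : ℂ) =
      -((κ - n * (2 * π * Complex.I)) * (2 * κ - (κ - n * (2 * π * Complex.I)))) := by
    rw [e1]
    have : z = -κ ^ 2 := by rw [hκz, neg_neg]
    rw [this]
    linear_combination -(4 * n ^ 2 * π ^ 2 : ℂ) * Complex.I_sq
  rw [e2, norm_neg, norm_mul]
  set δ := κ - n * (2 * π * Complex.I)
  have h5 : ‖2 * κ - δ‖ ≤ 2 * ‖κ‖ + ‖δ‖ := by
    refine (norm_sub_le _ _).trans ?_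
    simp
  have h6 : ‖δ‖ * ‖2 * κ - δ‖ ≤ (3 / 2 * d) * (2 * ‖κ‖ + 1 / 2) :=
    mul_le_mul hn (h5.trans (by linarith)) (norm_nonneg _) (by positivity)
  nlinarith

/-! ### The invariant plane contains the root vectors. -/

/-- Modulo the invariant plane, L - z is injective for z near -κ²: a y orthogonal to the
exponentials solves y'' = f + κ²y with |f| controlled by max |y|, and the gain 1/|κ| forces y = 0.
-/
theorem eq_zero_of_isPeriodicSolution_of_coef_eq_zero {q : ℝ → ℂ}
    (hq : IntervalIntegrable q volume 0 1) {κ z : ℂ} (hκ : κ.re = 0) (he : Complex.exp κ = 1)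
    (hbig : 84 * (∫ t in (0 : ℝ)..1, ‖q t‖) + 3 ≤ ‖κ‖) {φ : Fin 2 → ℝ → ℂ}
    (hφc : ∀ j, Continuous (φ j)) (hφb : ∀ j t, ‖φ j t‖ ≤ 2)
    (hφ : ∀ k j, coef κ k (φ j) = if k = j then 1 else 0)
    (hz : ‖z + κ ^ 2‖ ≤ 4 * (∫ t in (0 : ℝ)..1, ‖q t‖) + 1) {y dy : ℝ → ℂ} {c : Fin 2 → ℂ}
    (h : IsPeriodicSolution (fun x => q x * y x - (z * y x + ∑ k, c k * φ k x)) y dy)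
    (hy : ∀ k, coef κ k y = 0) : ∀ x ∈ Icc (0 : ℝ) 1, y x = 0 := by
  set Q := ∫ t in (0 : ℝ)..1, ‖q t‖ with hQ
  have hQ0 : 0 ≤ Q := intervalIntegral.integral_nonneg zero_le_one fun _ _ => norm_nonneg _
  obtain ⟨x₀, hx₀, hmax⟩ := exists_norm_max h.continuousOn
  have hyc : ContinuousOn y (uIcc 0 1) := by
    rw [uIcc_of_le zero_le_one]; exact h.continuousOn
  have iqy : IntervalIntegrable (fun x => q x * y x) volume 0 1 := hq.mul_continuousOn hyc
  have iy : IntervalIntegrable y volume 0 1 := hyc.intervalIntegrable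
  have iφ : ∀ k, IntervalIntegrable (φ k) volume 0 1 := fun k => (hφc k).intervalIntegrable _ _
  have isum := intervalIntegrable_sum_mul c iφ
  set f : ℝ → ℂ := ((fun x => q x * y x) - fun x => (z + κ ^ 2) * y x) -
    fun x => ∑ k, c k * φ k x with hf
  have hif : IntervalIntegrable f volume 0 1 := (iqy.sub (iy.const_mul _)).sub isum
  have h' : IsPeriodicSolution (fun x => f x + κ ^ 2 * y x) y dy := by
    refine h.congr (Filter.Eventually.of_forall fun x => ?_)
    simp only [hf, Pi.sub_apply]
    ring
  have hqyn : ∫ t in (0 : ℝ)..1, ‖q t * y t‖ ≤ Q * ‖y x₀‖ := by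
    refine (integral_norm_le_of_le hq iqy (a := ‖y x₀‖) (b := 0)
      fun t ht => ?_).trans_eq (add_zero _)
    rw [norm_mul, add_zero]
    exact mul_le_mul_of_nonneg_left (hmax t ht) (norm_nonneg _)
  -- The solvability condition identifies c_k with the k-th coefficient of qy, since y itself has
  -- zero coefficients.
  have hc : ∀ k, ‖c k‖ ≤ Q * ‖y x₀‖ := fun k => by
    have h1 : coef κ k f = 0 :=
      h'.expPrimitive_one (expo_sq κ k) hif (exp_expo he k)
    have i2 : IntervalIntegrable (fun x => (z + κ ^ 2) * y x) volume 0 1 := iy.const_mul _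
    have i1 : IntervalIntegrable ((fun x => q x * y x) - fun x => (z + κ ^ 2) * y x) volume 0 1 :=
      iqy.sub i2
    rw [hf, coef_sub i1 isum, coef_sub iqy i2,
      coef_const_mul, hy, coef_sum_mul c iφ] at h1
    simp only [hφ, mul_zero, sub_zero, mul_ite, mul_one, Finset.sum_ite_eq, Finset.mem_univ,
      if_true] at h1
    rw [← sub_eq_zero.1 h1]
    exact (norm_coef_le hκ iqy k).trans hqyn
  -- Q from qy, 4Q + 1 from z + κ², and 2Q from each of the two terms c_k φ_k. The a priori bound
  -- then gives |κ| max|y| ≤ (18Q + 2) max|y|, while |κ| ≥ 84Q + 3.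
  have hfn : ∫ t in (0 : ℝ)..1, ‖f t‖ ≤ (9 * Q + 1) * ‖y x₀‖ := by
    refine (integral_norm_le_of_le hq hif (a := ‖y x₀‖) (b := (8 * Q + 1) * ‖y x₀‖)
      fun t ht => ?_).trans_eq (by ring)
    have h1 : ‖q t * y t‖ ≤ ‖q t‖ * ‖y x₀‖ := by
      rw [norm_mul]
      exact mul_le_mul_of_nonneg_left (hmax t ht) (norm_nonneg _)
    have h2 : ‖(z + κ ^ 2) * y t‖ ≤ (4 * Q + 1) * ‖y x₀‖ := by
      rw [norm_mul]
      exact mul_le_mul hz (hmax t ht) (norm_nonneg _) (by positivity)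
    have h3 : ∀ k, ‖c k * φ k t‖ ≤ Q * ‖y x₀‖ * 2 := fun k => by
      rw [norm_mul]
      exact mul_le_mul (hc k) (hφb k t) (norm_nonneg _) (by positivity)
    have h4 := norm_add_le (c 0 * φ 0 t) (c 1 * φ 1 t)
    simp only [hf, Pi.sub_apply, Fin.sum_univ_two]
    linarith [norm_sub_le (q t * y t - (z + κ ^ 2) * y t) (c 0 * φ 0 t + c 1 * φ 1 t),
      norm_sub_le (q t * y t) ((z + κ ^ 2) * y t), h3 0, h3 1]
  have h1 := h'.norm_mul_le_of_orthogonal hκ hif he (by simpa [coef, expPrimitive, expo] using hy 0)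
    (by simpa [coef, expPrimitive, expo] using hy 1) hx₀
  have h2 : ‖y x₀‖ = 0 := by
    nlinarith [norm_nonneg (y x₀), mul_nonneg hQ0 (norm_nonneg (y x₀))]
  intro x hx
  have := hmax x hx
  rw [h2] at this
  simpa using this

theorem coef_congr_ae {κ : ℂ} {f g : ℝ → ℂ} (h : f =ᵐ[vol01] g) (k : Fin 2) :
    coef κ k f = coef κ k g := by
  apply integral_congr_vol01
  filter_upwards [h] with x hx
  rw [hx]

/-- For large `κ = 2πim`, there is a two-dimensional invariant subspace which contains all root
vectors for spectral parameters near `-κ²`. -/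
theorem exists_invariant_subspace {q : ℝ → ℂ} (hq : IntervalIntegrable q volume 0 1) {κ : ℂ}
    (hκ : κ.re = 0) (he : Complex.exp κ = 1)
    (hbig : 84 * (∫ t in (0 : ℝ)..1, ‖q t‖) + 3 ≤ ‖κ‖) :
    ∃ (B : Matrix (Fin 2) (Fin 2) ℂ) (Ψ : (Fin 2 → ℂ) →ₗ[ℂ] L2),
      Function.Injective Ψ ∧
      (∀ b, PeriodicSL q (Ψ b) (Ψ (B.toLin' b - κ ^ 2 • b))) ∧
      (∀ z : ℂ, ‖z + κ ^ 2‖ ≤ 4 * (∫ t in (0 : ℝ)..1, ‖q t‖) + 1 → ∀ u v, PeriodicSL q u v →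
        v - z • u ∈ LinearMap.range Ψ → u ∈ LinearMap.range Ψ) ∧
      (∀ k j, ‖B k j - coef κ k (fun t => q t * wave κ j t)‖ ≤
        36 * (∫ t in (0 : ℝ)..1, ‖q t‖) ^ 2 / ‖κ‖) := by
  have hQ0 : 0 ≤ ∫ t in (0 : ℝ)..1, ‖q t‖ :=
    intervalIntegral.integral_nonneg zero_le_one fun _ _ => norm_nonneg _
  have hκ0 : κ ≠ 0 := norm_pos_iff.1 (by linarith)
  obtain ⟨B, φ, dφ, hφc, hφb, hφ, hφo, hB⟩ := exists_invariant_pair hq hκ hκ0 he (by linarith)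
  have hmem : ∀ j, MemLp (φ j) 2 vol01 := fun j =>
    MemLp.of_bound (hφc j).aestronglyMeasurable 2 (Filter.Eventually.of_forall (hφb j))
  let Φ : Fin 2 → L2 := fun j => (hmem j).toLp
  have hΦ : ∀ j, Φ j =ᵐ[vol01] φ j := fun j => (hmem j).coeFn_toLp
  let Ψ : (Fin 2 → ℂ) →ₗ[ℂ] L2 := Fintype.linearCombination ℂ Φ
  have hΨ : ∀ b, Ψ b = b 0 • Φ 0 + b 1 • Φ 1 := fun b => by
    simp [Ψ, Fintype.linearCombination_apply]
  have hΨae : ∀ b, Ψ b =ᵐ[vol01] fun x => ∑ k, b k * φ k x := fun b => by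
    rw [hΨ]
    filter_upwards [Lp.coeFn_add (b 0 • Φ 0) (b 1 • Φ 1), Lp.coeFn_smul (b 0) (Φ 0),
      Lp.coeFn_smul (b 1) (Φ 1), hΦ 0, hΦ 1] with x h1 h2 h3 h4 h5
    rw [h1, Pi.add_apply, h2, h3, Pi.smul_apply, Pi.smul_apply, h4, h5, Fin.sum_univ_two,
      smul_eq_mul, smul_eq_mul]
  have iφ : ∀ k, IntervalIntegrable (φ k) volume 0 1 := fun k => (hφc k).intervalIntegrable _ _
  have hcoef : ∀ b k, coef κ k (Ψ b) = b k := fun b k => by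
    rw [coef_congr_ae (hΨae b), coef_sum_mul b iφ]
    simp [hφo]
  have hbasis : ∀ j, PeriodicSL q (Φ j) (Ψ (B.toLin' (Pi.single j 1) - κ ^ 2 • Pi.single j 1)) := by
    intro j
    refine periodicSL_iff.2 ⟨φ j, dφ j, hΦ j, (hφ j).congr ?_⟩
    filter_upwards [hΨae (B.toLin' (Pi.single j 1) - κ ^ 2 • Pi.single j 1)] with x hx
    rw [hx]
    simp only [Pi.sub_apply, Pi.smul_apply, smul_eq_mul, sub_mul, Finset.sum_sub_distrib,
      Matrix.toLin'_apply, Matrix.mulVec_single_one, Matrix.col_apply]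
    have : ∑ k, κ ^ 2 * (Pi.single j 1 : Fin 2 → ℂ) k * φ k x = κ ^ 2 * φ j x := by
      simp [Pi.single_apply]
    rw [this]
    ring
  have hSL : ∀ b, PeriodicSL q (Ψ b) (Ψ (B.toLin' b - κ ^ 2 • b)) := fun b => by
    have h1 := ((hbasis 0).smul (b 0)).add ((hbasis 1).smul (b 1))
    rw [← hΨ, ← map_smul, ← map_smul, ← map_add] at h1
    convert h1 using 2
    have h2 : b = b 0 • Pi.single 0 1 + b 1 • Pi.single 1 1 := by
      ext i; fin_cases i <;> simp
    conv_lhs => rw [h2]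
    simp only [map_add, map_smul, smul_add, smul_sub, smul_comm (κ ^ 2)]
    abel
  refine ⟨B, Ψ, fun b b' hbb => ?_, hSL, fun z hz u v huv hr => ?_, hB⟩
  · ext k
    rw [← hcoef b k, ← hcoef b' k, hbb]
  · obtain ⟨b, hb⟩ := hr
    -- Subtracting the element of the plane with the same coefficients as u leaves a vector
    -- orthogonal to the exponentials, still mapped by L - z into the plane.
    let c : Fin 2 → ℂ := fun k => coef κ k u
    have hw := huv.sub (hSL c)
    have hv : v - Ψ (B.toLin' c - κ ^ 2 • c) =
        z • (u - Ψ c) + Ψ (z • c + b - (B.toLin' c - κ ^ 2 • c)) := by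
      rw [map_sub Ψ (z • c + b), map_add, map_smul, hb, smul_sub]
      abel
    rw [hv] at hw
    obtain ⟨y, dy, h0, h⟩ := periodicSL_iff.1 hw
    have h' := h.congr (g := fun x => q x * y x - (z * y x +
      ∑ k, (z • c + b - (B.toLin' c - κ ^ 2 • c)) k * φ k x)) (by
        filter_upwards [Lp.coeFn_add (z • (u - Ψ c)) (Ψ (z • c + b - (B.toLin' c - κ ^ 2 • c))),
          Lp.coeFn_smul z (u - Ψ c), h0, hΨae (z • c + b - (B.toLin' c - κ ^ 2 • c))]
          with x h1 h2 h3 h4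
        rw [h1, Pi.add_apply, h2, Pi.smul_apply, h3, h4, smul_eq_mul])
    have hy : ∀ k, coef κ k y = 0 := fun k => by
      rw [← coef_congr_ae h0, coef_congr_ae (Lp.coeFn_sub u (Ψ c)),
        coef_sub (L2.intervalIntegrable u) (L2.intervalIntegrable (Ψ c)), hcoef, sub_self]
    have h1 := eq_zero_of_isPeriodicSolution_of_coef_eq_zero hq hκ he hbig hφc hφb hφo hz h' hy
    exact ⟨c, (sub_eq_zero.1 (L2.eq_zero_of_eqOn h0 h1)).symm⟩

/-! ### Algebraic multiplicity as a root multiplicity. -/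

theorem mem_periodicKer_succ {q : ℝ → ℂ} {z : ℂ} {n : ℕ} {u : L2} :
    u ∈ periodicKer q z (n + 1) ↔ ∃ v, PeriodicSL q u v ∧ v - z • u ∈ periodicKer q z n := Iff.rfl

theorem periodicMult_eq_zero {q : ℝ → ℂ} {z : ℂ} (h : ¬ IsPeriodicEigenvalue q z) :
    periodicMult q z = 0 := by
  have hker : ∀ n, periodicKer q z n = ⊥ := by
    intro n
    induction n with
    | zero => rfl
    | succ n ih =>
      rw [eq_bot_iff]
      rintro u ⟨v, huv, hv⟩
      rw [ih, Submodule.mem_bot, sub_eq_zero] at hv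
      by_contra hu
      exact h ⟨u, hu, hv ▸ huv⟩
  simp [periodicMult, hker]

/-- The hypothesis `hr` pulls each successive root vector back into the range of Ψ, where L acts as
A; induction on n then matches the two chains of kernels. -/
theorem periodicKer_eq_map {q : ℝ → ℂ} {z : ℂ} {V : Type*} [AddCommGroup V] [Module ℂ V]
    {Ψ : V →ₗ[ℂ] L2} {A : Module.End ℂ V} (hinj : Function.Injective Ψ)
    (hA : ∀ b, PeriodicSL q (Ψ b) (Ψ (A b)))
    (hr : ∀ u v, PeriodicSL q u v → v - z • u ∈ LinearMap.range Ψ → u ∈ LinearMap.range Ψ) (n : ℕ) :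
    periodicKer q z n = (A.genEigenspace z n).map Ψ := by
  induction n with
  | zero => simp [periodicKer]
  | succ n ih =>
    ext u
    rw [mem_periodicKer_succ, ih]
    have key : ∀ b, b ∈ A.genEigenspace z (n + 1 : ℕ) ↔ A b - z • b ∈ A.genEigenspace z n :=
      fun b => by
        simp only [Module.End.mem_genEigenspace_nat, LinearMap.mem_ker, pow_succ,
          Module.End.mul_apply]
        simp
    constructor
    · rintro ⟨v, huv, hv⟩
      obtain ⟨b, rfl⟩ := hr u v huv (LinearMap.map_le_range hv)
      refine ⟨b, (key b).2 ?_, rfl⟩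
      rw [huv.right_unique (hA b), ← map_smul, ← map_sub] at hv
      obtain ⟨b', hb', e⟩ := hv
      rwa [← hinj e]
    · rintro ⟨b, hb, rfl⟩
      refine ⟨_, hA b, ?_⟩
      rw [← map_smul, ← map_sub]
      exact Submodule.mem_map_of_mem ((key b).1 hb)

theorem periodicMult_eq_rootMultiplicity {q : ℝ → ℂ} {z : ℂ} {V : Type} [AddCommGroup V]
    [Module ℂ V] [FiniteDimensional ℂ V]
    {Ψ : V →ₗ[ℂ] L2} {A : Module.End ℂ V} (hinj : Function.Injective Ψ)
    (hA : ∀ b, PeriodicSL q (Ψ b) (Ψ (A b)))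
    (hr : ∀ u v, PeriodicSL q u v → v - z • u ∈ LinearMap.range Ψ → u ∈ LinearMap.range Ψ) :
    periodicMult q z = A.charpoly.rootMultiplicity z := by
  have h1 : (⨆ n, periodicKer q z n) = (A.maxGenEigenspace z).map Ψ := by
    simp_rw [periodicKer_eq_map hinj hA hr, ← Submodule.map_iSup,
      Module.End.iSup_genEigenspace_eq]
  rw [periodicMult, h1, ← (Submodule.equivMapOfInjective Ψ hinj _).rank_eq,
    ← Module.finrank_eq_rank, LinearMap.finrank_maxGenEigenspace_eq]
  simp

/-! ### The quantity ρ(m) and its lower bound. -/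

theorem norm_integral_mul_exp_le {q : ℝ → ℂ} (hq : IntervalIntegrable q volume 0 1) {g : ℝ → ℂ}
    (hg : ∀ t, ‖g t‖ = 1) {x : ℝ} (hx : x ∈ Icc (0 : ℝ) 1) :
    ‖∫ t in (0 : ℝ)..x, q t * g t‖ ≤ ∫ t in (0 : ℝ)..1, ‖q t‖ := by
  refine (intervalIntegral.norm_integral_le_integral_norm hx.1).trans ?_
  simp only [norm_mul, hg, mul_one]
  exact integral_norm_le_of_mem hq zero_mem_Icc01 hx hx.1

theorem norm_exp_neg_rho (m : ℕ) (t : ℝ) :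
    ‖Complex.exp (-(Complex.I * 2 * (2 * m) * π * t))‖ = 1 := by
  simp [Complex.norm_exp]

theorem norm_exp_rho (m : ℕ) (t : ℝ) :
    ‖Complex.exp (Complex.I * 2 * (2 * m) * π * t)‖ = 1 := by
  simp [Complex.norm_exp]

theorem norm_integral_neg_le_rho {q : ℝ → ℂ} (hq : IntervalIntegrable q volume 0 1) (m : ℕ)
    {x : ℝ} (hx : x ∈ Icc (0 : ℝ) 1) :
    ‖∫ t in (0 : ℝ)..x, q t * Complex.exp (-(Complex.I * 2 * (2 * m) * π * t))‖ ≤ rho q m := by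
  refine le_trans ?_ (le_max_left _ _)
  exact le_ciSup (f := fun x : Icc (0 : ℝ) 1 =>
    ‖∫ t in (0 : ℝ)..x, q t * Complex.exp (-(Complex.I * 2 * (2 * m) * π * t))‖)
    ⟨_, forall_mem_range.2 fun x => norm_integral_mul_exp_le hq (norm_exp_neg_rho m) x.2⟩ ⟨x, hx⟩

theorem norm_integral_le_rho {q : ℝ → ℂ} (hq : IntervalIntegrable q volume 0 1) (m : ℕ)
    {x : ℝ} (hx : x ∈ Icc (0 : ℝ) 1) :
    ‖∫ t in (0 : ℝ)..x, q t * Complex.exp (Complex.I * 2 * (2 * m) * π * t)‖ ≤ rho q m := by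
  refine le_trans ?_ (le_max_right _ _)
  exact le_ciSup (f := fun x : Icc (0 : ℝ) 1 =>
    ‖∫ t in (0 : ℝ)..x, q t * Complex.exp (Complex.I * 2 * (2 * m) * π * t)‖)
    ⟨_, forall_mem_range.2 fun x => norm_integral_mul_exp_le hq (norm_exp_rho m) x.2⟩ ⟨x, hx⟩

theorem rho_le {q : ℝ → ℂ} (hq : IntervalIntegrable q volume 0 1) (m : ℕ) :
    rho q m ≤ ∫ t in (0 : ℝ)..1, ‖q t‖ :=
  have : Nonempty (Icc (0 : ℝ) 1) := ⟨⟨0, zero_mem_Icc01⟩⟩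
  max_le (ciSup_le fun x => norm_integral_mul_exp_le hq (norm_exp_neg_rho m) x.2)
    (ciSup_le fun x => norm_integral_mul_exp_le hq (norm_exp_rho m) x.2)

theorem rho_nonneg {q : ℝ → ℂ} (hq : IntervalIntegrable q volume 0 1) (m : ℕ) : 0 ≤ rho q m :=
  (norm_nonneg _).trans (norm_integral_le_rho hq m zero_mem_Icc01)

/-- With F(x) = ∫₀ˣ q e^{ct}, integration by parts gives ∫₀ˣ q = e^{-cx}F(x) + c ∫₀ˣ e^{-ct}F(t) dt,
where |F| ≤ ρ(m) and |c| = 4πm. -/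
theorem norm_integral_le_mul_rho {q : ℝ → ℂ} (hq : IntervalIntegrable q volume 0 1) (m : ℕ)
    {x : ℝ} (hx : x ∈ Icc (0 : ℝ) 1) :
    ‖∫ t in (0 : ℝ)..x, q t‖ ≤ rho q m * (1 + 4 * π * m) := by
  set c : ℂ := Complex.I * 2 * (2 * m) * π with hc
  have hcn : ‖c‖ = 4 * π * m := by
    simp [hc, abs_of_pos Real.pi_pos]
    ring
  have hcr : c.re = 0 := by simp [hc]
  have hF : ∀ x ∈ Icc (0 : ℝ) 1, ‖expPrimitive (-c) q x‖ ≤ rho q m := fun x hx => by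
    have := norm_integral_le_rho hq m hx
    simpa only [expPrimitive, neg_neg, mul_comm (q _)] using this
  have hiF : IntervalIntegrable (fun t => Complex.exp (-c * t) * expPrimitive (-c) q t)
      volume 0 1 := intervalIntegrable_cexp_mul (intervalIntegrable_expPrimitive hq) _
  have h1 := ((absolutelyContinuousOnInterval_cexp_mul (-c)).smul
    (absolutelyContinuousOnInterval_integral (intervalIntegrable_cexp_mul hq c))).eq_add_integral
    (f := fun t => -c * (Complex.exp (-c * t) * expPrimitive (-c) q t) + q t)
    ((hiF.const_mul _).add hq) (by
      rw [ae_vol01_iff]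
      filter_upwards [(intervalIntegrable_cexp_mul hq c).ae_hasDerivAt_integral] with t ht ht'
      have h2 := ht (by rwa [uIcc_of_le zero_le_one]) 0 (by simp)
      refine ((hasDerivAt_cexp_mul (-c) t).mul h2).congr_deriv ?_
      rw [expPrimitive, neg_neg]
      linear_combination q t * exp_mul_exp_neg c t) hx
  rw [intervalIntegral.integral_add
    ((intervalIntegrable_of_mem hiF zero_mem_Icc01 hx).const_mul _)
    (intervalIntegrable_of_mem hq zero_mem_Icc01 hx), intervalIntegral.integral_const_mul] at h1
  have h2 : ∫ t in (0 : ℝ)..x, q t = Complex.exp (-c * x) * expPrimitive (-c) q x +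
      c * ∫ t in (0 : ℝ)..x, Complex.exp (-c * t) * expPrimitive (-c) q t := by
    simp only [Pi.smul_apply', smul_eq_mul, intervalIntegral.integral_same, mul_zero,
      zero_add] at h1
    have h3 : expPrimitive (-c) q x = ∫ t in (0 : ℝ)..x, Complex.exp (c * t) * q t := by
      simp only [expPrimitive, neg_neg]
    rw [h3]
    linear_combination -h1
  have h4 : ‖∫ t in (0 : ℝ)..x, Complex.exp (-c * t) * expPrimitive (-c) q t‖ ≤ rho q m := by
    have := intervalIntegral.norm_integral_le_of_norm_le_const (a := (0 : ℝ)) (b := x)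
      (f := fun t => Complex.exp (-c * t) * expPrimitive (-c) q t) (C := rho q m) (fun t ht => by
        rw [uIoc_of_le hx.1] at ht
        rw [norm_mul, norm_exp_mul_of_re_eq_zero (by simpa), one_mul]
        exact hF t ⟨ht.1.le, ht.2.trans hx.2⟩)
    rw [sub_zero, abs_of_nonneg hx.1] at this
    exact this.trans (mul_le_of_le_one_right (rho_nonneg hq m) hx.2)
  rw [h2]
  refine (norm_add_le _ _).trans ?_
  rw [norm_mul, norm_exp_mul_of_re_eq_zero (by simpa), one_mul, norm_mul, hcn]
  have := mul_le_mul_of_nonneg_left h4 (by positivity : (0 : ℝ) ≤ 4 * π * m)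
  linarith [hF x hx]

theorem ae_eq_zero_of_integral_eq_zero {q : ℝ → ℂ} (hq : IntervalIntegrable q volume 0 1)
    (h : ∀ x ∈ Icc (0 : ℝ) 1, ∫ t in (0 : ℝ)..x, q t = 0) : q =ᵐ[vol01] 0 := by
  have h1 := ae_vol01_iff.2 (by simpa using hq.ae_hasDerivAt_integral)
  filter_upwards [h1, ae_vol01_mem_Ioo] with x hx hx'
  have h2 : (fun x => ∫ t in (0 : ℝ)..x, q t) =ᶠ[nhds x] fun _ => 0 := by
    filter_upwards [Icc_mem_nhds hx'.1 hx'.2] with t ht using h t ht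
  exact ((hx 0 le_rfl zero_le_one).congr_of_eventuallyEq h2.symm).unique (hasDerivAt_const x 0)

theorem exists_div_lt_rho {q : ℝ → ℂ} (hq : IntervalIntegrable q volume 0 1)
    (h : ¬ q =ᵐ[vol01] 0) : ∃ c : ℝ, 0 < c ∧ ∀ m : ℕ, 1 ≤ m → c / m < rho q m := by
  obtain ⟨x, hx, hx0⟩ : ∃ x ∈ Icc (0 : ℝ) 1, ∫ t in (0 : ℝ)..x, q t ≠ 0 := by
    by_contra! H
    exact h (ae_eq_zero_of_integral_eq_zero hq H)
  have hp := norm_pos_iff.2 hx0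
  -- The 20 comes from 1 + 4πm < 20m, valid for m ≥ 1.
  refine ⟨‖∫ t in (0 : ℝ)..x, q t‖ / 20, by positivity, fun m hm => ?_⟩
  have hm' : (1 : ℝ) ≤ m := by exact_mod_cast hm
  have h1 := norm_integral_le_mul_rho hq m hx
  have h2 : 1 + 4 * π * m < 20 * m := by nlinarith [Real.pi_lt_four]
  have h3 : 0 < rho q m := by
    refine lt_of_le_of_ne (rho_nonneg hq m) fun h0 => ?_
    rw [← h0, zero_mul] at h1
    linarith
  rw [div_lt_iff₀ (by linarith)]
  nlinarith

/-! ### Eigenvalue pairs and the final count. -/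

theorem exists_charpoly_roots {A : Module.End ℂ (Fin 2 → ℂ)} : ∃ l : Fin 2 → ℂ,
    (∀ j, A.HasEigenvalue (l j)) ∧
    ∀ z, ((A.charpoly.rootMultiplicity z : ℕ) : ℕ∞) = {j | l j = z}.encard := by
  have hdeg : A.charpoly.natDegree = 2 := by
    rw [LinearMap.charpoly_natDegree]; simp
  have hcard : A.charpoly.roots.card = 2 := by
    rw [← (IsAlgClosed.splits A.charpoly).natDegree_eq_card_roots, hdeg]
  obtain ⟨a, b, hab⟩ := Multiset.card_eq_two.1 hcard
  have hroot : ∀ x ∈ A.charpoly.roots, A.HasEigenvalue x := fun x hx =>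
    Module.End.hasEigenvalue_iff_isRoot_charpoly _ _|>.2 (Polynomial.isRoot_of_mem_roots hx)
  refine ⟨![a, b], fun j => hroot _ ?_, fun z => ?_⟩
  · rw [hab]
    fin_cases j <;> simp
  · classical
    have : {j : Fin 2 | ![a, b] j = z} = ((Finset.univ.filter fun j => ![a, b] j = z : Finset _) :
        Set (Fin 2)) := by simp
    rw [this, encard_coe_eq_coe_finsetCard, ← Polynomial.count_roots, hab, Finset.card_filter,
      Fin.sum_univ_two]
    simp only [Multiset.insert_eq_cons, Multiset.count_cons, Multiset.count_singleton]
    simp only [Matrix.cons_val_zero, Matrix.cons_val_one, eq_comm (a := z)]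
    rw [add_comm]
    by_cases ha : a = z <;> by_cases hb : b = z <;> simp [ha, hb]

theorem norm_le_of_toLin'_eq_smul {B : Matrix (Fin 2) (Fin 2) ℂ} {M : ℝ}
    (hB : ∀ k j, ‖B k j‖ ≤ M) {b : Fin 2 → ℂ} (hb : b ≠ 0) {w : ℂ} (h : B.toLin' b = w • b) :
    ‖w‖ ≤ 2 * M := by
  have hbp : 0 < ‖b‖ := norm_pos_iff.2 hb
  have h1 : ‖w • b‖ ≤ 2 * M * ‖b‖ := by
    rw [← h]
    refine (pi_norm_le_iff_of_nonneg (by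
      have := (norm_nonneg _).trans (hB 0 0)
      positivity)).2 fun k => ?_
    rw [Matrix.toLin'_apply, Matrix.mulVec, dotProduct, Fin.sum_univ_two]
    have h2 : ∀ j, ‖B k j * b j‖ ≤ M * ‖b‖ := fun j => by
      rw [norm_mul]
      exact mul_le_mul (hB k j) (norm_le_pi_norm b j) (norm_nonneg _)
        ((norm_nonneg _).trans (hB 0 0))
    linarith [norm_add_le (B k 0 * b 0) (B k 1 * b 1), h2 0, h2 1]
  rw [norm_smul] at h1
  exact le_of_mul_le_mul_right h1 hbp

/-- The pair of eigenvalues near `(2πm)²`. -/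
theorem exists_eigenvalue_pair {q : ℝ → ℂ} (hq : IntervalIntegrable q volume 0 1)
    (hq0 : ∫ t in (0 : ℝ)..1, q t = 0) {m : ℕ}
    (hm : 84 * (∫ t in (0 : ℝ)..1, ‖q t‖) + 3 ≤ m) :
    ∃ l : Fin 2 → ℂ, (∀ j, IsPeriodicEigenvalue q (l j)) ∧
      (∀ z : ℂ, ‖z - ((2 * m * π) ^ 2 : ℝ)‖ ≤ 4 * (∫ t in (0 : ℝ)..1, ‖q t‖) + 1 →
        periodicMult q z = {j | l j = z}.encard) ∧
      ∀ j, ‖l j - ((2 * m * π) ^ 2 : ℝ)‖ ≤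
        2 * (rho q m + 36 * (∫ t in (0 : ℝ)..1, ‖q t‖) ^ 2 / (2 * m * π)) := by
  set Q := ∫ t in (0 : ℝ)..1, ‖q t‖ with hQ
  have hQ0 : 0 ≤ Q := intervalIntegral.integral_nonneg zero_le_one fun _ _ => norm_nonneg _
  set κ : ℂ := m * (2 * π * Complex.I) with hκd
  have hκn : ‖κ‖ = 2 * m * π := by
    simp [hκd, abs_of_pos Real.pi_pos]
    ring
  have hκr : κ.re = 0 := by simp [hκd]
  have he : Complex.exp κ = 1 := Complex.exp_nat_mul_two_pi_mul_I m
  have hκ2 : -κ ^ 2 = (((2 * m * π) ^ 2 : ℝ) : ℂ) := by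
    rw [hκd]
    push_cast
    linear_combination -(4 * m ^ 2 * π ^ 2 : ℂ) * Complex.I_sq
  have hbig : 84 * Q + 3 ≤ ‖κ‖ := by
    rw [hκn]
    nlinarith [Real.pi_gt_three]
  obtain ⟨B, Ψ, hinj, hSL, hr, hB⟩ := exists_invariant_subspace hq hκr he hbig
  rw [← hκ2, ← hκn]
  let A : Module.End ℂ (Fin 2 → ℂ) := B.toLin' - κ ^ 2 • 1
  have hA : ∀ b, PeriodicSL q (Ψ b) (Ψ (A b)) := hSL
  obtain ⟨l, hl, hlz⟩ := exists_charpoly_roots (A := A)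
  have hcoef : ∀ k j, ‖coef κ k (fun t => q t * wave κ j t)‖ ≤ rho q m := by
    -- The exponentials cancel on the diagonal and leave ∫q; this is where the zero mean enters.
    have hdiag : ∀ k, coef κ k (fun t => q t * wave κ k t) = 0 := fun k => by
      rw [← hq0, coef, expPrimitive]
      congr 1 with t
      rw [wave]
      linear_combination q t * exp_mul_exp_neg (expo κ k) t
    intro k j
    fin_cases k <;> fin_cases j
    · exact (norm_eq_zero.2 (hdiag 0)).trans_le (rho_nonneg hq m)
    · refine le_trans (le_of_eq ?_) (norm_integral_neg_le_rho hq m one_mem_Icc01)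
      congr 1
      simp only [coef, expPrimitive, wave, expo, Fin.zero_eta, Fin.mk_one, Matrix.cons_val_zero,
        Matrix.cons_val_one]
      congr 1 with t
      rw [mul_left_comm, ← Complex.exp_add, hκd]
      ring_nf
    · refine le_trans (le_of_eq ?_) (norm_integral_le_rho hq m one_mem_Icc01)
      congr 1
      simp only [coef, expPrimitive, wave, expo, Fin.zero_eta, Fin.mk_one, Matrix.cons_val_zero,
        Matrix.cons_val_one]
      congr 1 with t
      rw [mul_left_comm, ← Complex.exp_add, hκd]
      ring_nf
    · exact (norm_eq_zero.2 (hdiag 1)).trans_le (rho_nonneg hq m)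
  have hBn : ∀ k j, ‖B k j‖ ≤ rho q m + 36 * Q ^ 2 / ‖κ‖ := fun k j => by
    have := norm_add_le (coef κ k (fun t => q t * wave κ j t))
      (B k j - coef κ k (fun t => q t * wave κ j t))
    rw [add_sub_cancel] at this
    linarith [hcoef k j, hB k j]
  refine ⟨l, fun j => ?_, fun z hz => ?_, fun j => ?_⟩
  · obtain ⟨b, hb⟩ := (hl j).exists_hasEigenvector
    refine ⟨Ψ b, fun h0 => hb.2 (hinj (h0.trans (map_zero Ψ).symm)), ?_⟩
    rw [← map_smul, ← hb.apply_eq_smul]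
    exact hA b
  · rw [sub_neg_eq_add] at hz
    rw [periodicMult_eq_rootMultiplicity hinj hA (hr z hz), hlz]
  · obtain ⟨b, hb⟩ := (hl j).exists_hasEigenvector
    refine norm_le_of_toLin'_eq_smul hBn hb.2 ?_
    have := hb.apply_eq_smul
    simp only [A, LinearMap.sub_apply, LinearMap.smul_apply, Module.End.one_apply] at this
    rw [sub_neg_eq_add, add_smul, ← this, sub_add_cancel]

/-- Distinct centres (2πm)², (2πm')² are at least 4π²(m + m') apart, more than 2K when m, m' ≥ K. -/
theorem eq_of_norm_sub_le {m m' : ℕ} {z : ℂ} {K : ℝ} (hm : K ≤ m) (hm' : K ≤ m')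
    (hK : 1 ≤ K) (h : ‖z - ((2 * m * π) ^ 2 : ℝ)‖ ≤ K) (h' : ‖z - ((2 * m' * π) ^ 2 : ℝ)‖ ≤ K) :
    m = m' := by
  wlog hlt : m < m' generalizing m m'
  · rcases (not_lt.1 hlt).eq_or_lt with h1 | h1
    · exact h1.symm
    · exact (this hm' hm h' h h1).symm
  exfalso
  have h1 : ‖(((2 * m' * π) ^ 2 : ℝ) : ℂ) - ((2 * m * π) ^ 2 : ℝ)‖ ≤ 2 * K := by
    have := norm_sub_le (z - ((2 * m * π) ^ 2 : ℝ)) (z - ((2 * m' * π) ^ 2 : ℝ))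
    rw [sub_sub_sub_cancel_left] at this
    linarith
  rw [← Complex.ofReal_sub, Complex.norm_real, Real.norm_eq_abs] at h1
  have h2 := (le_abs_self _).trans h1
  have h3 : (m : ℝ) + 1 ≤ m' := by exact_mod_cast hlt
  have h4 : 9 ≤ π ^ 2 := by nlinarith [Real.pi_gt_three]
  have h5 : (2 * m' * π) ^ 2 - (2 * m * π) ^ 2 = 4 * π ^ 2 * ((m' - m) * (m' + m)) := by ring
  have h6 : 2 * K ≤ (m' - m : ℝ) * (m' + m) := by nlinarith
  rw [h5] at h2
  nlinarith

theorem lemma2 (q : ℝ → ℂ) (hq : IntegrableOn q (Icc (0 : ℝ) 1) volume)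
    (hq0 : ∫ t in (0 : ℝ)..1, q t = 0) :
    (∃ (N : ℕ) (R C : ℝ) (lam : ℕ → Fin 2 → ℂ),
      1 ≤ N ∧
      (∀ m, N ≤ m → ∀ j, IsPeriodicEigenvalue q (lam m j) ∧ R < ‖lam m j‖) ∧
      (∀ z : ℂ, R < ‖z‖ →
        periodicMult q z = {p : ℕ × Fin 2 | N ≤ p.1 ∧ lam p.1 p.2 = z}.encard) ∧
      (∀ m, N ≤ m → ∀ j, ‖lam m j - ((2 * m * π) ^ 2 : ℝ)‖ ≤ C * rho q m)) ∧
    (¬ (q =ᵐ[vol01] 0) →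
      ∃ (N : ℕ) (c : ℝ), 1 ≤ N ∧ 0 < c ∧ ∀ m : ℕ, N ≤ m → c / m < rho q m) := by
  have hi : IntervalIntegrable q volume 0 1 := intervalIntegrable_iff_vol01.2 hq
  refine ⟨?_, fun h => ?_⟩
  swap
  · obtain ⟨c, hc, H⟩ := exists_div_lt_rho hi h
    exact ⟨1, c, le_rfl, hc, H⟩
  set Q := ∫ t in (0 : ℝ)..1, ‖q t‖ with hQ
  have hQ0 : 0 ≤ Q := intervalIntegral.integral_nonneg zero_le_one fun _ _ => norm_nonneg _
  obtain ⟨C, hC⟩ : ∃ C : ℝ, ∀ m : ℕ, 1 ≤ m →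
      2 * (rho q m + 36 * Q ^ 2 / (2 * m * π)) ≤ C * rho q m := by
    by_cases h : q =ᵐ[vol01] 0
    · have : Q = 0 := by
        rw [hQ, integral_congr_vol01 (g := fun _ => (0 : ℝ)) (by
          filter_upwards [h] with x hx
          simp [hx])]
        simp
      exact ⟨2, fun m _ => by simp [this]⟩
    · obtain ⟨c, hc, H⟩ := exists_div_lt_rho hi h
      -- Part (b) turns the O(1/m) error into a multiple of ρ(m), through 1/m ≤ ρ(m)/c.
      refine ⟨2 * (1 + 36 * Q ^ 2 / c), fun m hm => ?_⟩
      have hm' : (1 : ℝ) ≤ m := by exact_mod_cast hm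
      have h1 : 36 * Q ^ 2 / (2 * m * π) ≤ 36 * Q ^ 2 / c * (c / m) := by
        rw [div_mul_div_cancel₀ hc.ne']
        gcongr
        nlinarith [Real.pi_gt_three]
      have h2 : 36 * Q ^ 2 / c * (c / m) ≤ 36 * Q ^ 2 / c * rho q m := by
        gcongr
        exact (H m hm).le
      linarith
  obtain ⟨N, hN⟩ := exists_nat_ge (84 * Q + 3)
  have hN1 : 1 ≤ N := by
    have : (1 : ℝ) ≤ N := by linarith
    exact_mod_cast this
  have hex : ∀ m : ℕ, ∃ l : Fin 2 → ℂ, N ≤ m → (∀ j, IsPeriodicEigenvalue q (l j)) ∧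
      (∀ z : ℂ, ‖z - ((2 * m * π) ^ 2 : ℝ)‖ ≤ 4 * Q + 1 → periodicMult q z = {j | l j = z}.encard) ∧
      ∀ j, ‖l j - ((2 * m * π) ^ 2 : ℝ)‖ ≤ 2 * (rho q m + 36 * Q ^ 2 / (2 * m * π)) := fun m => by
    by_cases hm : N ≤ m
    · have hm' : (N : ℝ) ≤ m := by exact_mod_cast hm
      obtain ⟨l, hl⟩ := exists_eigenvalue_pair hi hq0 (m := m) (by linarith)
      exact ⟨l, fun _ => hl⟩
    -- A dummy value: indices below N are never counted.
    · exact ⟨0, fun h => absurd h hm⟩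
  choose lam hlam using hex
  have hπ : 9 ≤ π ^ 2 := by nlinarith [Real.pi_gt_three]
  have hclose : ∀ m, N ≤ m → ∀ j, ‖lam m j - ((2 * m * π) ^ 2 : ℝ)‖ ≤ 4 * Q + 1 := fun m hm j => by
    refine ((hlam m hm).2.2 j).trans ?_
    have hm' : (N : ℝ) ≤ m := by exact_mod_cast hm
    have h1 : 36 * Q ^ 2 / (2 * m * π) ≤ Q := by
      rw [div_le_iff₀ (by nlinarith [Real.pi_gt_three])]
      have : 36 * Q ≤ 2 * m * π := by nlinarith [Real.pi_gt_three]
      nlinarith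
    linarith [rho_le hi m]
  have hnorm : ∀ m : ℕ, ‖(((2 * m * π) ^ 2 : ℝ) : ℂ)‖ = (2 * m * π) ^ 2 := fun m => by
    rw [Complex.norm_real, Real.norm_of_nonneg (sq_nonneg _)]
  -- R lies just below the disc around (2πN)², with an extra 1 for strictness, yet above every disc
  -- with m < N, because the gap 4π²(2N - 1) exceeds 8Q + 3.
  refine ⟨N, (2 * N * π) ^ 2 - (4 * Q + 1) - 1, C, lam, hN1, fun m hm j =>
    ⟨(hlam m hm).1 j, ?_⟩, fun z hz => ?_, fun m hm j =>
    ((hlam m hm).2.2 j).trans (hC m (hN1.trans hm))⟩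
  · have h1 := norm_sub_norm_le (((2 * m * π) ^ 2 : ℝ) : ℂ) (lam m j)
    rw [norm_sub_rev, hnorm] at h1
    have h2 : (2 * N * π) ^ 2 ≤ (2 * m * π) ^ 2 := by gcongr
    linarith [hclose m hm j]
  · by_cases hz' : ∃ m, N ≤ m ∧ ‖z - ((2 * m * π) ^ 2 : ℝ)‖ ≤ 4 * Q + 1
    · obtain ⟨m, hm, hzm⟩ := hz'
      rw [(hlam m hm).2.1 z hzm, ← (Prod.mk_right_injective m).encard_image]
      congr 1
      ext ⟨m', j⟩
      constructor
      · rintro ⟨j', hj', h⟩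
        obtain ⟨rfl, rfl⟩ := Prod.mk.inj h
        exact ⟨hm, hj'⟩
      · rintro ⟨hm', h⟩
        dsimp only at hm' h
        have k1 : (N : ℝ) ≤ m := by exact_mod_cast hm
        have k2 : (N : ℝ) ≤ m' := by exact_mod_cast hm'
        -- Disjointness of the discs: only the index m contributes to the multiplicity of z.
        obtain rfl : m = m' := eq_of_norm_sub_le (by linarith) (by linarith) (by linarith) hzm
          (h ▸ hclose m' hm' j)
        exact ⟨j, h, rfl⟩
    · push Not at hz'
      have hempty : {p : ℕ × Fin 2 | N ≤ p.1 ∧ lam p.1 p.2 = z} = ∅ := by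
        ext ⟨m, j⟩
        simp only [mem_ofPred_eq, mem_empty_iff_false, iff_false, not_and]
        exact fun hm h => absurd (h ▸ hclose m hm j) (hz' m hm).not_ge
      rw [hempty, encard_empty]
      refine periodicMult_eq_zero fun ⟨u, hu, h⟩ => ?_
      obtain ⟨m, hm⟩ := exists_nat_norm_sub_le_of_periodicSL hi hu h (by
        refine le_trans ?_ hz.le
        rw [← hQ]
        have h1 : (4 * Q + 1) ^ 2 ≤ (N : ℝ) ^ 2 := by
          gcongr
          linarith
        have h2 : 36 * (N : ℝ) ^ 2 ≤ (2 * N * π) ^ 2 := by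
          have : (2 * N * π) ^ 2 = 4 * π ^ 2 * (N : ℝ) ^ 2 := by ring
          nlinarith [sq_nonneg (N : ℝ)]
        have h3 : (N : ℝ) ≤ (N : ℝ) ^ 2 := by nlinarith
        linarith)
      rcases le_or_gt N m with hNm | hNm
      · exact absurd hm (hz' m hNm).not_ge
      -- An eigenvalue in a disc of index m < N has modulus at most (2π(N - 1))² + 4Q + 1, which is
      -- below R.
      · have h1 := norm_le_norm_add_norm_sub' z (((2 * m * π) ^ 2 : ℝ) : ℂ)
        rw [hnorm] at h1
        have h2 : (m : ℝ) + 1 ≤ N := by exact_mod_cast hNm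
        have h3 : (2 * m * π) ^ 2 ≤ (2 * (N - 1 : ℝ) * π) ^ 2 := by
          gcongr
          linarith
        have h4 : (2 * N * π) ^ 2 - (2 * (N - 1 : ℝ) * π) ^ 2 = 4 * π ^ 2 * (2 * N - 1) := by ring
        nlinarith
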